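/- Let $\log$ denote the natural logarithm. The twin-width $\operatorname{tww}(G)$ of a finite simple graph $G$ is the least integer $w \ge 0$ such that $V(G)$ can be reduced from the partition into singletons to a partition with (at most) one part by repeatedly merging two parts, in such a way that at every stage every part $A$ has at most $w$ other parts $B$ for which $A$ and $B$ are neither fully adjacent nor fully non-adjacent in $G$. The maximum average degree is $\operatorname{mad}(G) = \max_{H} \frac{2e(H)}{v(H)}$, where $H$ ranges over the subgraphs of $G$ with at least one vertex, and $v(H)$, $e(H)$ are the numbers of vertices and edges of $H$. (i) There is an absolute constant $C$ such that for every integer $d > 2$ and every $n$-vertex $d$-regular graph $G$, $$\operatorname{tww}(G) \le n^{\frac{d-2}{2d-2}} \cdot \exp\!\left(C\left(d^{-1}\sqrt{\log n}\cdot \log\log n + \log d\right)\right).$$ (ii) For every $\varepsilon > 0$ there is a constant $C$, depending only on $\varepsilon$, such that the following holds for every sequence $m = m(n)$ of integers with $(1+\varepsilon) n \le m \le \binom{n}{2}$ for all sufficiently large $n$. If $G$ is chosen uniformly at random among all graphs with vertex set of size $n$ (labelled) and exactly $m$ edges, and $d = \operatorname{mad}(G)$, then with probability tending to $1$ as $n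 \to \infty$, $$\operatorname{tww}(G) \le n^{\frac{d-2}{2d-2}} \cdot \exp\!\left(C\left(d^{-1}\sqrt{\log n}\cdot \log\log n + \log d\right)\right).$$ -/

import Mathlib

open Filter Topology ProbabilityTheory

namespace SparseTwinWidth

section TwinWidth

variable {V : Type*}

/-- Two sets of vertices are homogeneous in `G` if they are fully adjacent or fully
non-adjacent. -/
def Homogeneous (G : SimpleGraph V) (A B : Finset V) : Prop :=
  (∀ a ∈ A, ∀ b ∈ B, G.Adj a b) ∨ (∀ a ∈ A, ∀ b ∈ B, ¬ G.Adj a b)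

/-- The red degree of the part `A` in the quotient of `G` by the family of parts `P`: the number
of other parts that are joined to `A` by a red edge, that is, that are not homogeneous to `A`. -/
noncomputable def redDegree (G : SimpleGraph V) (P : Finset (Finset V)) (A : Finset V) : ℕ :=
  {B : Finset V | B ∈ P ∧ B ≠ A ∧ ¬ Homogeneous G A B}.ncard

/-- `Q` arises from the family of parts `P` by identifying (merging) two distinct parts. -/
def IsMerge [DecidableEq V] (P Q : Finset (Finset V)) : Prop :=
  ∃ A ∈ P, ∃ B ∈ P, A ≠ B ∧ Q = insert (A ∪ B) ((P.erase A).erase B)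

/-- `G` has a contraction sequence `P 0, …, P k` of width at most `w`: it starts with the
partition of the vertex set into singletons, each step identifies two parts, at most one part
remains at the end (exactly one unless `G` has no vertices), and at each time each part is
incident with at most `w` red edges. -/
def HasContractionSequence [Fintype V] [DecidableEq V] (G : SimpleGraph V) (w : ℕ) : Prop :=
  ∃ (k : ℕ) (P : ℕ → Finset (Finset V)),
    P 0 = Finset.univ.image (fun v : V => ({v} : Finset V)) ∧
    (∀ i < k, IsMerge (P i) (P (i + 1))) ∧
    (P k).card ≤ 1 ∧
    ∀ i ≤ k, ∀ A ∈ P i, redDegree G (P i) A ≤ w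

open Classical in
/-- The twin-width of a finite graph: the least width of a contraction sequence. -/
noncomputable def tww [Fintype V] (G : SimpleGraph V) : ℕ :=
  sInf {w : ℕ | HasContractionSequence G w}

/-- The maximum average degree of a finite graph: the maximum of `2 e(H) / v(H)` over all
subgraphs `H` with at least one vertex. -/
noncomputable def mad (G : SimpleGraph V) : ℝ :=
  ⨆ H : {H : G.Subgraph // H.verts.Nonempty},
    2 * (H.1.edgeSet.ncard : ℝ) / (H.1.verts.ncard : ℝ)

end TwinWidth

/-- The bound `n ^ ((d-2)/(2d-2)) * exp (C * (d⁻¹ * √(log n) * log log n + log d))`. -/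
noncomputable def upperBound (C : ℝ) (n : ℕ) (d : ℝ) : ℝ :=
  (n : ℝ) ^ ((d - 2) / (2 * d - 2)) *
    Real.exp (C * (d⁻¹ * √(Real.log n) * Real.log (Real.log n) + Real.log d))

/-- The set of graphs with vertex set `Fin n` and exactly `m` edges. -/
def graphsWithEdges (n m : ℕ) : Set (SimpleGraph (Fin n)) :=
  {G | G.edgeSet.ncard = m}

end SparseTwinWidth

/-!
The proof contracts the graph `G` along a homomorphism into a sparse universal graph, in the manner
of the universal graphs of Alon and Capalbo for graphs of bounded degree.

Suppose that every subgraph of `G` has average degree at most `d`, and choose integers with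
`a / N` slightly smaller than `2 / d`. By Hall's theorem and an edge colouring of a bipartite
multigraph, there are `N` functional graphs on the vertex set such that every edge of `G` belongs to
at least `a` of them (`exists_functional_cover`). In each functional graph every vertex gets an
independent random letter from an alphabet of size `r`, and reads off the letters of its first `t`
iterated images, starting with itself. This maps the functional graph into the de Bruijn graph on
`r ^ t` words, whose degree is only `2 * r`. Short cycles would make a vertex read the same letter twice; therefore every
cycle is first folded onto a path, which is continued by virtual ancestors (`ancestor`). Together,
the `N` words map `G` to the graph on `p = r ^ (t * N)` vertices in which two vertices are adjacent
if they are adjacent or equal in at least `a` coordinates. Its degree `wordDegree` is about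
`p ^ (1 - a / N)`, up to the factors `N.choose a` and `(2 * r + 1) ^ a`.

Since a letter is shared by few vertices, the words are equidistributed (`exists_letters`): every
fibre has `O(n / p)` vertices. With `p = n ^ (d / (2 * d - 2))` both `n / p` and
`p ^ (1 - 2 / d)` are equal to `n ^ ((d - 2) / (2 * d - 2))`. The contraction sequence first merges
the fibres and then drops the last letters one after the other (`tww_le_of_words`); each step
unites at most `r` parts into one, so it increases red degrees by at most a factor `r`.

The choice `a ≈ √(log n) / d`, `N ≈ a * d / 2` balances the rounding error of `a / N` against these
factors, for `r` polylogarithmic in `n`; this yields the error term of `upperBound`.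
When `d` exceeds a multiple of `log n / log log n`, no suitable alphabet is left, but then the bound
`O(Δ √n)` suffices. The outcome is `exists_forall_tww_le_upperBound`, for graphs of maximum degree
at most `d (log n) ^ 2`. It applies to regular graphs by double counting, and to random graphs
because a first moment computation for stars bounds the maximum degree
(`uniformOn_graphsWithEdges_large_degree_le`).
-/

namespace SparseTwinWidth

/-! ### Contraction sequences from chains of partitions -/

section Contraction

open Finset

variable {V α β : Type*}

/-- The partition of `V` into the nonempty fibres of `φ`, as a family of parts. -/
def fiberParts [Fintype V] [DecidableEq V] [DecidableEq α] (φ : V → α) : Finset (Finset V) :=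
  univ.image fun v => univ.filter fun u => φ u = φ v

/-- The quotient of `G` by the fibres of `φ` has degree at most `w`: the neighbours of each fibre
take at most `w` values under `φ`. Loops of the quotient are counted as well. -/
def QuotientDegreeLE (G : SimpleGraph V) (φ : V → α) (w : ℕ) : Prop :=
  ∀ v, Set.ncard {y | ∃ u u', φ u = φ v ∧ G.Adj u u' ∧ φ u' = y} ≤ w

/-- `Q` arises from `P` by merging two parts, and all red degrees of `Q` are at most `w`. -/
def MergeStep [DecidableEq V] (G : SimpleGraph V) (w : ℕ) (P Q : Finset (Finset V)) : Prop :=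
  IsMerge P Q ∧ ∀ A ∈ Q, redDegree G Q A ≤ w

theorem mem_fiberParts [Fintype V] [DecidableEq V] [DecidableEq α] {φ : V → α} {A : Finset V} :
    A ∈ fiberParts φ ↔ ∃ v, (univ.filter fun u => φ u = φ v) = A := by
  simp [fiberParts]

theorem fiberParts_congr [Fintype V] [DecidableEq V] [DecidableEq α] [DecidableEq β]
    {φ : V → α} {χ : V → β} (h : ∀ u v, φ u = φ v ↔ χ u = χ v) :
    fiberParts φ = fiberParts χ := by
  simp only [fiberParts, h]

theorem QuotientDegreeLE.redDegree_le [Fintype V] [DecidableEq V] [DecidableEq α]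
    {G : SimpleGraph V} {φ : V → α} {w : ℕ}
    (h : QuotientDegreeLE G φ w) {A : Finset V} (hA : A ∈ fiberParts φ) :
    redDegree G (fiberParts φ) A ≤ w := by
  obtain ⟨v, rfl⟩ := mem_fiberParts.1 hA
  refine le_trans ?_ (h v)
  rw [redDegree]
  have hsub : {B : Finset V | B ∈ fiberParts φ ∧ B ≠ (univ.filter fun u => φ u = φ v) ∧
      ¬ Homogeneous G (univ.filter fun u => φ u = φ v) B} ⊆
      (fun y => univ.filter fun u => φ u = y) ''
        {y | ∃ u u', φ u = φ v ∧ G.Adj u u' ∧ φ u' = y} := by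
    rintro B ⟨hB, -, hBh⟩
    obtain ⟨w, rfl⟩ := mem_fiberParts.1 hB
    simp only [Homogeneous, not_or, not_forall, not_not] at hBh
    obtain ⟨-, a, ha, b, hb, hab⟩ := hBh
    simp only [mem_filter, mem_univ, true_and] at ha hb
    exact ⟨φ w, ⟨a, b, ha, hab, hb⟩, rfl⟩
  have hfin : {y | ∃ u u', φ u = φ v ∧ G.Adj u u' ∧ φ u' = y}.Finite :=
    (Set.finite_range φ).subset (by rintro y ⟨u, u', -, -, rfl⟩; exact ⟨u', rfl⟩)
  exact (Set.ncard_le_ncard hsub (hfin.image _)).trans (Set.ncard_image_le hfin)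

/-- A quotient between `φ` and a coarser `χ` has parts that are unions of at most `b` parts
of `φ`, so its degree is at most `b` times that of `φ`. -/
theorem QuotientDegreeLE.of_between [Fintype V] {γ : Type*} {G : SimpleGraph V}
    {φ : V → α} {ψ : V → γ} {χ : V → β} {w b : ℕ}
    (h : QuotientDegreeLE G φ w) (hφψ : ∀ u v, φ u = φ v → ψ u = ψ v)
    (hψχ : ∀ u v, ψ u = ψ v → χ u = χ v)
    (hb : ∀ v, Set.ncard (φ '' {u | χ u = χ v}) ≤ b) : QuotientDegreeLE G ψ (b * w) := by
  classical
  intro v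
  rcases isEmpty_or_nonempty V with hV | hV
  · exact hV.elim v
  -- a section of `φ` lets `ψ` be read off from the values of `φ`
  obtain ⟨s, hs⟩ : ∃ s : α → V, ∀ u, φ (s (φ u)) = φ u :=
    ⟨Function.invFun φ, fun u => Function.invFun_eq ⟨u, rfl⟩⟩
  let X : Finset α := (univ.filter fun u => χ u = χ v).image φ
  have hX : X.card ≤ b := by
    rw [← Set.ncard_coe_finset]
    refine le_of_eq_of_le ?_ (hb v)
    congr 1
    ext; simp [X]
  let Y : α → Finset α := fun x =>
    (univ.filter fun u' => ∃ u, φ u = x ∧ G.Adj u u').image φ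
  have hY : ∀ x ∈ X, (Y x).card ≤ w := by
    intro x hx
    obtain ⟨u, -, rfl⟩ := Finset.mem_image.1 hx
    rw [← Set.ncard_coe_finset]
    refine le_of_eq_of_le ?_ (h u)
    congr 1
    ext y
    simp only [coe_image, coe_filter, mem_univ, true_and, Set.mem_image, Set.mem_ofPred_eq, Y]
    constructor
    · rintro ⟨u', ⟨u, h1, h2⟩, h3⟩
      exact ⟨u, u', h1, h2, h3⟩
    · rintro ⟨u, u', h1, h2, h3⟩
      exact ⟨u', ⟨u, h1, h2⟩, h3⟩
  have hcard : (X.biUnion Y).card ≤ b * w :=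
    (card_biUnion_le_card_mul X Y w hY).trans (Nat.mul_le_mul_right w hX)
  refine le_trans ?_ hcard
  rw [← Set.ncard_coe_finset]
  refine le_trans (Set.ncard_le_ncard (t := (fun x => ψ (s x)) '' (X.biUnion Y : Set α)) ?_
    ((Finset.finite_toSet _).image _)) (Set.ncard_image_le (Finset.finite_toSet _))
  rintro y ⟨u, u', h1, h2, rfl⟩
  refine ⟨φ u', ?_, hφψ _ _ (hs u')⟩
  simp only [Finset.mem_coe, Finset.mem_biUnion]
  refine ⟨φ u, Finset.mem_image.2 ⟨u, by simp [hψχ _ _ h1], rfl⟩, ?_⟩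
  exact Finset.mem_image.2 ⟨u', by simpa using ⟨u, rfl, h2⟩, rfl⟩

/-- Identifying two values of `φ` merges two of its fibres. -/
theorem isMerge_fiberParts [Fintype V] [DecidableEq V] [DecidableEq α]
    (φ : V → α) {u v : V} (huv : φ u ≠ φ v) :
    IsMerge (fiberParts φ) (fiberParts fun x => if φ x = φ v then φ u else φ x) := by
  refine ⟨univ.filter fun x => φ x = φ u, mem_fiberParts.2 ⟨u, rfl⟩,
    univ.filter fun x => φ x = φ v, mem_fiberParts.2 ⟨v, rfl⟩, ?_, ?_⟩
  · intro h
    have : u ∈ univ.filter fun x => φ x = φ v := h ▸ (by simp)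
    exact huv (by simpa using this)
  · ext A
    rw [mem_insert, mem_erase, mem_erase, mem_fiberParts, mem_fiberParts]
    constructor
    · rintro ⟨z, rfl⟩
      by_cases hz : φ z = φ u ∨ φ z = φ v
      · left
        ext x
        simp only [mem_filter, mem_univ, true_and, mem_union]
        split_ifs <;> grind
      · push Not at hz
        right
        have hz' : (univ.filter fun x => (if φ x = φ v then φ u else φ x) =
            if φ z = φ v then φ u else φ z) = univ.filter fun x => φ x = φ z := by
          ext x
          simp only [mem_filter, mem_univ, true_and]
          split_ifs <;> grind
        rw [hz']
        refine ⟨?_, ?_, z, rfl⟩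
        · intro h
          have : z ∈ univ.filter fun x => φ x = φ v := h ▸ (by simp)
          exact hz.2 (by simpa using this)
        · intro h
          have : z ∈ univ.filter fun x => φ x = φ u := h ▸ (by simp)
          exact hz.1 (by simpa using this)
    · rintro (rfl | ⟨h1, h2, z, rfl⟩)
      · refine ⟨u, ?_⟩
        ext x
        simp only [mem_filter, mem_univ, true_and, mem_union]
        split_ifs <;> grind
      · refine ⟨z, ?_⟩
        have hzv : φ z ≠ φ v := fun h => h1 (by simp [h])
        have hzu : φ z ≠ φ u := fun h => h2 (by simp [h])
        ext x
        simp only [mem_filter, mem_univ, true_and]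
        split_ifs <;> grind

/-- Coarsening `φ` to `χ` by merging its parts one at a time, in any order. All partitions on the
way lie between `φ` and `χ`, so their red degrees are at most `b * w`. -/
theorem reachable_of_refines [Fintype V] [DecidableEq V] [DecidableEq α] [DecidableEq β]
    {G : SimpleGraph V} {φ : V → α} {χ : V → β} {w b : ℕ}
    (h : QuotientDegreeLE G φ w) (hφχ : ∀ u v, φ u = φ v → χ u = χ v)
    (hb : ∀ v, Set.ncard (φ '' {u | χ u = χ v}) ≤ b) :
    Relation.ReflTransGen (MergeStep G (b * w)) (fiberParts φ) (fiberParts χ) := by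
  suffices H : ∀ (k : ℕ) (ψ : V → α), (univ.image ψ).card ≤ k → (∀ u v, φ u = φ v → ψ u = ψ v) →
      (∀ u v, ψ u = ψ v → χ u = χ v) →
      Relation.ReflTransGen (MergeStep G (b * w)) (fiberParts ψ) (fiberParts χ) from
    H _ φ le_rfl (fun _ _ => id) hφχ
  intro k
  induction k with
  | zero =>
    intro ψ hk h1 h2
    have hV : IsEmpty V := by
      by_contra hV
      rw [not_isEmpty_iff] at hV
      obtain ⟨v⟩ := hV
      have : ψ v ∈ univ.image ψ := mem_image_of_mem _ (mem_univ v)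
      simp_all
    rw [fiberParts_congr (χ := χ)]
    intro u
    exact hV.elim u
  | succ k ih =>
    intro ψ hk h1 h2
    by_cases hc : ∀ u v, χ u = χ v → ψ u = ψ v
    · rw [fiberParts_congr (χ := χ) fun u v => ⟨h2 u v, hc u v⟩]
    · push Not at hc
      obtain ⟨u, v, huv, hne⟩ := hc
      set ψ' : V → α := fun x => if ψ x = ψ v then ψ u else ψ x with hψ'
      have h1' : ∀ x y, φ x = φ y → ψ' x = ψ' y := by
        intro x y hxy
        simp only [hψ', h1 x y hxy]
      have h2' : ∀ x y, ψ' x = ψ' y → χ x = χ y := by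
        intro x y hxy
        simp only [hψ'] at hxy
        split_ifs at hxy with hx hy hy
        · exact h2 _ _ (hx.trans hy.symm)
        · rw [h2 _ _ hx, ← huv, h2 _ _ hxy]
        · rw [h2 _ _ hxy, huv, ← h2 _ _ hy]
        · exact h2 _ _ hxy
      refine Relation.ReflTransGen.head ⟨isMerge_fiberParts ψ hne, fun A hA =>
        (h.of_between h1' h2' hb).redDegree_le hA⟩ (ih ψ' ?_ h1' h2')
      have hlt : (univ.image ψ').card < (univ.image ψ).card := by
        refine card_lt_card ((ssubset_iff_of_subset ?_).2 ⟨ψ v, by simp, ?_⟩)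
        · intro y hy
          obtain ⟨x, -, rfl⟩ := mem_image.1 hy
          simp only [hψ']
          split_ifs <;> simp
        · intro hy
          obtain ⟨x, -, hx⟩ := mem_image.1 hy
          simp only [hψ'] at hx
          split_ifs at hx with h'
          · exact hne hx
          · exact h' hx
      omega

theorem mergeStep_mono [DecidableEq V] {G : SimpleGraph V} {w w' : ℕ} (hw : w ≤ w')
    {P Q : Finset (Finset V)}
    (h : Relation.ReflTransGen (MergeStep G w) P Q) :
    Relation.ReflTransGen (MergeStep G w') P Q := by
  induction h with
  | refl => rfl
  | tail _ h ih => exact ih.tail ⟨h.1, fun A hA => (h.2 A hA).trans hw⟩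

theorem exists_sequence_of_reachable [DecidableEq V] {G : SimpleGraph V} {w : ℕ}
    {P Q : Finset (Finset V)}
    (hP : ∀ A ∈ P, redDegree G P A ≤ w) (h : Relation.ReflTransGen (MergeStep G w) P Q) :
    ∃ (k : ℕ) (S : ℕ → Finset (Finset V)), S 0 = P ∧ (∀ i < k, IsMerge (S i) (S (i + 1))) ∧
      S k = Q ∧ ∀ i ≤ k, ∀ A ∈ S i, redDegree G (S i) A ≤ w := by
  induction h using Relation.ReflTransGen.head_induction_on with
  | refl => exact ⟨0, fun _ => Q, rfl, by simp, rfl, fun i _ => hP⟩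
  | @head A B hstep _ ih =>
    obtain ⟨k, S, h0, hm, hk, hr⟩ := ih hstep.2
    refine ⟨k + 1, fun i => Nat.casesOn i A S, rfl, ?_, hk, ?_⟩
    · rintro (_ | i) hi
      · simpa [h0] using hstep.1
      · exact hm i (by omega)
    · rintro (_ | i) hi
      · exact hP
      · exact hr i (by omega)

/-- A sequence of merges from singletons to the fibres of a constant map bounds the twin-width. -/
theorem tww_le_of_reachable [Fintype V] [DecidableEq β] {G : SimpleGraph V} {w : ℕ} {χ : V → β}
    (hχ : ∀ u v, χ u = χ v)
    (hid : letI := Classical.decEq V; ∀ A ∈ fiberParts (id : V → V),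
      redDegree G (fiberParts (id : V → V)) A ≤ w)
    (h : letI := Classical.decEq V;
      Relation.ReflTransGen (MergeStep G w) (fiberParts (id : V → V)) (fiberParts χ)) :
    tww G ≤ w := by
  classical
  refine Nat.sInf_le ?_
  obtain ⟨k, S, h0, hm, hk, hr⟩ := exists_sequence_of_reachable hid h
  refine ⟨k, S, ?_, ?_, ?_, ?_⟩
  · rw [h0]
    ext A
    simp only [fiberParts, id, Finset.mem_image, Finset.mem_univ, true_and]
    refine exists_congr fun v => ?_
    rw [show (univ.filter fun x => x = v) = {v} by ext; simp]
  · convert hm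
  · rw [hk, card_le_one]
    intro A hA B hB
    obtain ⟨u, rfl⟩ := mem_fiberParts.1 hA
    obtain ⟨v, rfl⟩ := mem_fiberParts.1 hB
    rw [hχ u v]
  · exact hr

/-- The discrete partition has degree at most the maximum degree. -/
theorem quotientDegreeLE_id {G : SimpleGraph V} {w : ℕ}
    (h : ∀ v, (G.neighborSet v).ncard ≤ w) : QuotientDegreeLE G (id : V → V) w := by
  intro v
  refine le_of_eq_of_le ?_ (h v)
  congr 1
  ext y
  simp

end Contraction

/-! ### Words and powers of de Bruijn graphs -/

section DeBruijn

open Finset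

/-- Adjacency of infinite words in the undirected de Bruijn graph with loops: one word is the
shift of the other, or they agree. -/
def WordAdj {α : Type*} (x y : ℕ → α) : Prop :=
  (∀ j, x (j + 1) = y j) ∨ (∀ j, y (j + 1) = x j) ∨ x = y

open Classical in
/-- The neighbours of a word of length `l` in the undirected de Bruijn graph with loops. -/
noncomputable def wordNeighbors {r l : ℕ} (x : Fin l → Fin r) : Finset (Fin l → Fin r) :=
  univ.filter fun y => (∀ (j : ℕ) (h : j + 1 < l), x ⟨j + 1, h⟩ = y ⟨j, by omega⟩) ∨
    (∀ (j : ℕ) (h : j + 1 < l), y ⟨j + 1, h⟩ = x ⟨j, by omega⟩) ∨ y = x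

theorem card_wordNeighbors_le {r l : ℕ} (hr : 0 < r) (x : Fin l → Fin r) :
    (wordNeighbors x).card ≤ 2 * r + 1 := by
  classical
  rcases l with _ | l
  · refine (card_le_one.2 fun a _ b _ => Subsingleton.elim a b).trans (by omega)
  have h1 : (univ.filter fun y : Fin (l + 1) → Fin r =>
      ∀ (j : ℕ) (h : j + 1 < l + 1), x ⟨j + 1, h⟩ = y ⟨j, by omega⟩).card ≤ r := by
    -- a left shift is determined by its last letter
    refine (card_le_card_of_injOn (t := (univ : Finset (Fin r))) (fun y => y (Fin.last l))
      (by simp) ?_).trans (by simp)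
    intro y hy z hz hyz
    simp only [coe_filter, mem_univ, true_and, Set.mem_ofPred_eq] at hy hz
    ext j : 1
    rcases Fin.eq_castSucc_or_eq_last j with ⟨j, rfl⟩ | rfl
    · exact (hy j (by omega)).symm.trans (hz j (by omega))
    · exact hyz
  have h2 : (univ.filter fun y : Fin (l + 1) → Fin r =>
      ∀ (j : ℕ) (h : j + 1 < l + 1), y ⟨j + 1, h⟩ = x ⟨j, by omega⟩).card ≤ r := by
    -- a right shift is determined by its first letter
    refine (card_le_card_of_injOn (t := (univ : Finset (Fin r))) (fun y => y 0)
      (by simp) ?_).trans (by simp)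
    intro y hy z hz hyz
    simp only [coe_filter, mem_univ, true_and, Set.mem_ofPred_eq] at hy hz
    ext j : 1
    rcases Fin.eq_zero_or_eq_succ j with rfl | ⟨j, rfl⟩
    · exact hyz
    · exact (hy j (by omega)).trans (hz j (by omega)).symm
  rw [wordNeighbors, filter_or, filter_or]
  refine (card_union_le _ _).trans ?_
  have h3 := card_union_le (univ.filter fun y : Fin (l + 1) → Fin r =>
      ∀ (j : ℕ) (h : j + 1 < l + 1), y ⟨j + 1, h⟩ = x ⟨j, by omega⟩) (univ.filter fun y => y = x)
  have h4 : (univ.filter fun y : Fin (l + 1) → Fin r => y = x).card ≤ 1 :=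
    card_le_one.2 (by simp)
  omega

variable {V : Type*} {N r : ℕ}

/-- The first `ℓ i` letters of the `i`-th word, for every `i`. -/
def truncWords (L : V → Fin N → ℕ → Fin r) (ℓ : Fin N → ℕ) (v : V) :
    ∀ i, Fin (ℓ i) → Fin r :=
  fun i j => L v i j

theorem truncWords_eq_iff {L : V → Fin N → ℕ → Fin r} {ℓ : Fin N → ℕ} {u v : V} :
    truncWords L ℓ u = truncWords L ℓ v ↔ ∀ i, ∀ j < ℓ i, L u i j = L v i j := by
  constructor
  · intro h i j hj
    exact congr_fun (congr_fun h i) ⟨j, hj⟩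
  · intro h
    ext i j : 2
    exact h i j j.2

/-- The number of neighbours of a vertex in the `N`-fold power of the de Bruijn graph on words of
length `t`, where vertices are adjacent if they are so in at least `a` coordinates. -/
def wordDegree (N a r t : ℕ) : ℕ :=
  N.choose a * ((2 * r + 1) ^ a * (r ^ t) ^ (N - a))

theorem quotientDegreeLE_truncWords {G : SimpleGraph V} {a t : ℕ} (hr : 0 < r)
    {L : V → Fin N → ℕ → Fin r}
    (hL : ∀ u v, G.Adj u v → ∃ S : Finset (Fin N), S.card = a ∧ ∀ i ∈ S, WordAdj (L u i) (L v i))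
    {ℓ : Fin N → ℕ} (hℓ : ∀ i, ℓ i ≤ t) :
    QuotientDegreeLE G (truncWords L ℓ) (wordDegree N a r t) := by
  classical
  intro v
  set x := truncWords L ℓ v with hx
  let T : Finset (Fin N) → Finset (∀ i, Fin (ℓ i) → Fin r) := fun S =>
    Fintype.piFinset fun i => if i ∈ S then wordNeighbors (x i) else univ
  have hT : ∀ S ∈ powersetCard a (univ : Finset (Fin N)),
      (T S).card ≤ (2 * r + 1) ^ a * (r ^ t) ^ (N - a) := by
    intro S hS
    rw [mem_powersetCard_univ] at hS
    rw [Fintype.card_piFinset]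
    calc ∏ i, (if i ∈ S then wordNeighbors (x i) else univ).card
        ≤ ∏ i, (if i ∈ S then 2 * r + 1 else r ^ t) := by
          refine prod_le_prod' fun i _ => ?_
          split_ifs
          · exact card_wordNeighbors_le hr _
          · simpa using Nat.pow_le_pow_right hr (hℓ i)
      _ = (2 * r + 1) ^ a * (r ^ t) ^ (N - a) := by
          rw [prod_ite, prod_const, prod_const, filter_mem_eq_inter, univ_inter, hS,
            filter_not, filter_mem_eq_inter, univ_inter, card_sdiff_of_subset (subset_univ _), hS,
            card_univ, Fintype.card_fin]
  have hcard : ((powersetCard a univ).biUnion T).card ≤ wordDegree N a r t := by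
    refine (card_biUnion_le_card_mul _ T _ hT).trans ?_
    rw [card_powersetCard, card_univ, Fintype.card_fin, wordDegree]
  refine le_trans ?_ hcard
  rw [← Set.ncard_coe_finset]
  refine Set.ncard_le_ncard ?_ (Finset.finite_toSet _)
  rintro y ⟨u, u', h1, h2, rfl⟩
  obtain ⟨S, hS, hadj⟩ := hL u u' h2
  simp only [Finset.mem_coe, Finset.mem_biUnion, mem_powersetCard_univ]
  refine ⟨S, hS, ?_⟩
  simp only [T, Fintype.mem_piFinset]
  intro i
  split_ifs with hi
  · rw [← h1]
    refine mem_filter.2 ⟨mem_univ _, ?_⟩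
    rcases hadj i hi with h | h | h
    · exact Or.inl fun j _ => h j
    · exact Or.inr (Or.inl fun j _ => h j)
    · exact Or.inr (Or.inr (funext fun j => (congr_fun h j).symm))
  · exact mem_univ _

/-- A system of words for the vertices that sends edges to edges of the power of the de Bruijn
graph and has fibres of size at most `B` bounds the twin-width: the vertices with the same words
are merged first, and then the last letters are dropped one by one. -/
theorem tww_le_of_words [Fintype V] {G : SimpleGraph V} {a t B Δ : ℕ} (hr : 0 < r)
    {L : V → Fin N → ℕ → Fin r}
    (hL : ∀ u v, G.Adj u v → ∃ S : Finset (Fin N), S.card = a ∧ ∀ i ∈ S, WordAdj (L u i) (L v i))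
    (hB : ∀ v, {u | ∀ i, ∀ j < t, L u i j = L v i j}.ncard ≤ B)
    (hΔ : ∀ v, (G.neighborSet v).ncard ≤ Δ) :
    tww G ≤ max (B * Δ) (r * wordDegree N a r t) := by
  classical
  have hB0 : ∀ v : V, 1 ≤ B := fun v => le_trans
    ((Set.ncard_pos (Set.toFinite _)).2 ⟨v, by simp⟩) (hB v)
  have hid := quotientDegreeLE_id hΔ
  refine tww_le_of_reachable (χ := truncWords L fun _ => 0) ?_ ?_ ?_
  · intro u v
    rw [truncWords_eq_iff]
    omega
  · intro A hA
    obtain ⟨v, -⟩ := mem_fiberParts.1 hA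
    exact (hid.redDegree_le hA).trans
      ((Nat.le_mul_of_pos_left _ (hB0 v)).trans (le_max_left _ _))
  -- `s` is the total number of letters that remain
  have key : ∀ (s : ℕ) (ℓ : Fin N → ℕ), (∀ i, ℓ i ≤ t) → ∑ i, ℓ i = s →
      Relation.ReflTransGen (MergeStep G (r * wordDegree N a r t))
        (fiberParts (truncWords L ℓ)) (fiberParts (truncWords L fun _ => 0)) := by
    intro s
    induction s with
    | zero =>
      intro ℓ _ hs
      have : ℓ = fun _ => 0 := by
        ext i
        exact (sum_eq_zero_iff.1 hs) i (mem_univ i)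
      rw [this]
    | succ s ih =>
      intro ℓ hℓ hs
      obtain ⟨i, hi⟩ : ∃ i, ℓ i ≠ 0 := by
        by_contra! h
        simp [h] at hs
      set ℓ' := Function.update ℓ i (ℓ i - 1) with hℓ'
      have hle : ∀ k, ℓ' k ≤ ℓ k := by
        intro k
        by_cases hk : k = i
        · subst hk; simp [hℓ']
        · simp [hℓ', hk]
      refine (reachable_of_refines (quotientDegreeLE_truncWords hr hL hℓ)
        (χ := truncWords L ℓ') (b := r) ?_ ?_).trans (ih ℓ' (fun k => (hle k).trans (hℓ k)) ?_)
      · intro u v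
        simp only [truncWords_eq_iff]
        exact fun h k j hj => h k j (hj.trans_le (hle k))
      · intro v
        -- the removed letter distinguishes the parts that are merged into one
        let p : (∀ i, Fin (ℓ i) → Fin r) → Fin r := fun y => y i ⟨ℓ i - 1, by omega⟩
        have hinj : Set.InjOn p
            (truncWords L ℓ '' {u | truncWords L ℓ' u = truncWords L ℓ' v}) := by
          rintro _ ⟨u, hu, rfl⟩ _ ⟨w, hw, rfl⟩ h
          have huw := (show truncWords L ℓ' u = _ from hu).trans
            (show truncWords L ℓ' w = _ from hw).symm
          rw [truncWords_eq_iff] at huw ⊢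
          intro k j hj
          by_cases hk : k = i
          · subst hk
            by_cases hj' : j = ℓ k - 1
            · subst hj'; exact h
            · exact huw k j (by simp only [hℓ', Function.update_self]; omega)
          · exact huw k j (by simpa [hℓ', hk] using hj)
        rw [← hinj.ncard_image]
        refine (Set.ncard_le_ncard (Set.subset_univ _)).trans ?_
        simp [Set.ncard_univ]
      · have := sum_update_of_mem (mem_univ i) ℓ (ℓ i - 1)
        have h2 := add_sum_erase univ ℓ (mem_univ i)
        rw [hℓ', this, sdiff_singleton_eq_erase]
        omega
  refine (mergeStep_mono (le_max_left _ _) (reachable_of_refines hid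
    (χ := truncWords L fun _ => t) (b := B) ?_ ?_)).trans
    (mergeStep_mono (le_max_right _ _) (key _ (fun _ => t) (fun _ => le_rfl) rfl))
  · rintro u v h
    rw [show u = v from h]
  · intro v
    refine le_of_eq_of_le ?_ (hB v)
    congr 1
    ext u
    simp [truncWords_eq_iff]

end DeBruijn

/-! ### Folding functional graphs into forests -/

section FunctionalGraph

open Function

variable {V : Type*} (g : V → V)

/-- A point of the forward orbit of `v` that depends only on the orbit: the vertex at which the
cycle through a periodic point `v` is folded. -/
noncomputable def cycleRoot (v : V) : V :=
  @Classical.epsilon V ⟨v⟩ fun w => w ∈ {w | ∃ j, g^[j] v = w}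

theorem exists_iterate_eq_cycleRoot (v : V) : ∃ j, g^[j] v = cycleRoot g v := by
  have := @Classical.epsilon_spec V (fun w => w ∈ {w | ∃ j, g^[j] v = w}) ⟨v, 0, rfl⟩
  exact this

open Classical in
/-- The number of steps from `v` to the root of its cycle. -/
noncomputable def cycleDist (v : V) : ℕ := Nat.find (exists_iterate_eq_cycleRoot g v)

theorem iterate_cycleDist (v : V) : g^[cycleDist g v] v = cycleRoot g v := by
  classical
  exact Nat.find_spec (exists_iterate_eq_cycleRoot g v)

theorem cycleDist_le {v : V} {j : ℕ} (h : g^[j] v = cycleRoot g v) : cycleDist g v ≤ j := by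
  classical
  exact Nat.find_min' _ h

/-- The height of a periodic point: its distance to the root of its cycle in either direction.
Folding the cycle identifies the at most two points of equal height. -/
noncomputable def cycleHeight (v : V) : ℤ :=
  min (cycleDist g v : ℤ) ((minimalPeriod g v : ℤ) - cycleDist g v)

variable {g}

theorem apply_mem_periodicPts {v : V} (hv : v ∈ periodicPts g) : g v ∈ periodicPts g := by
  obtain ⟨n, hn, h⟩ := hv
  exact ⟨n, hn, h.apply⟩

theorem cycleRoot_apply {v : V} (hv : v ∈ periodicPts g) : cycleRoot g (g v) = cycleRoot g v := by
  have : {w | ∃ j, g^[j] (g v) = w} = {w | ∃ j, g^[j] v = w} := by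
    ext w
    constructor
    · rintro ⟨j, rfl⟩
      exact ⟨j + 1, by simp⟩
    · rintro ⟨j, rfl⟩
      obtain ⟨n, hn, h⟩ := hv
      refine ⟨j + (n - 1), ?_⟩
      rw [← iterate_succ_apply, show (j + (n - 1)).succ = j + n by omega, iterate_add_apply, h]
  simp only [cycleRoot, this]

theorem cycleDist_apply {v : V} (hv : v ∈ periodicPts g) :
    (cycleDist g v ≠ 0 ∧ cycleDist g (g v) + 1 = cycleDist g v) ∨
      (cycleDist g v = 0 ∧ cycleDist g (g v) + 1 = minimalPeriod g v) := by
  rcases Nat.eq_zero_or_pos (cycleDist g v) with h0 | h0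
  · right
    refine ⟨h0, ?_⟩
    have hroot : v = cycleRoot g v := by simpa [h0] using iterate_cycleDist g v
    have hpos := minimalPeriod_pos_of_mem_periodicPts hv
    apply le_antisymm
    · have : cycleDist g (g v) ≤ minimalPeriod g v - 1 := by
        apply cycleDist_le
        rw [cycleRoot_apply hv, ← hroot, ← iterate_succ_apply,
          show (minimalPeriod g v - 1).succ = minimalPeriod g v by omega]
        exact isPeriodicPt_minimalPeriod g v
      omega
    · refine IsPeriodicPt.minimalPeriod_le (by omega) ?_
      have := iterate_cycleDist g (g v)
      rw [cycleRoot_apply hv, ← hroot, ← iterate_succ_apply] at this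
      exact this
  · left
    refine ⟨h0.ne', le_antisymm ?_ ?_⟩
    · have : cycleDist g (g v) ≤ cycleDist g v - 1 := by
        apply cycleDist_le
        rw [cycleRoot_apply hv, ← iterate_succ_apply,
          show (cycleDist g v - 1).succ = cycleDist g v by omega, iterate_cycleDist]
      omega
    · apply cycleDist_le
      rw [iterate_succ_apply, iterate_cycleDist, cycleRoot_apply hv]

theorem cycleHeight_apply {v : V} (hv : v ∈ periodicPts g) :
    cycleHeight g v = cycleHeight g (g v) + 1 ∨ cycleHeight g (g v) = cycleHeight g v + 1 ∨
      cycleHeight g v = cycleHeight g (g v) := by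
  have h1 : minimalPeriod g (g v) = minimalPeriod g v := minimalPeriod_apply hv
  have hpos := minimalPeriod_pos_of_mem_periodicPts hv
  simp only [cycleHeight, h1]
  rcases cycleDist_apply hv with ⟨_, h⟩ | ⟨h0, h⟩ <;> omega

theorem eq_of_cycleDist_eq {u v : V} (hu : u ∈ periodicPts g) (hv : v ∈ periodicPts g)
    (hroot : cycleRoot g u = cycleRoot g v) (hdist : cycleDist g u = cycleDist g v) : u = v := by
  have h := iterate_cycleDist g u
  rw [hroot, ← iterate_cycleDist g v, hdist] at h
  have key : ∀ j, g^[j] u = g^[j] v → u = v := by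
    intro j hj
    obtain ⟨m, hm, hu'⟩ := hu
    obtain ⟨n, hn, hv'⟩ := hv
    have hu2 : IsPeriodicPt g (m * n * (j + 1)) u := (hu'.mul_const n).mul_const _
    have hv2 : IsPeriodicPt g (m * n * (j + 1)) v := (hv'.const_mul m).mul_const _
    have hle : j ≤ m * n * (j + 1) := by
      have : 0 < m * n := Nat.mul_pos hm hn
      nlinarith
    obtain ⟨k, hk⟩ := Nat.exists_eq_add_of_le' hle
    rw [hk] at hu2 hv2
    rw [IsPeriodicPt, IsFixedPt, iterate_add_apply] at hu2 hv2
    rw [← hu2, ← hv2, hj]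
  exact key _ h

theorem minimalPeriod_cycleRoot {v : V} (hv : v ∈ periodicPts g) :
    minimalPeriod g (cycleRoot g v) = minimalPeriod g v := by
  rw [← iterate_cycleDist g v, minimalPeriod_apply_iterate hv]

/-- At most two periodic points are folded together. -/
theorem ncard_cycleHeight_le [Finite V] (ρ : V) (κ : ℤ) :
    {v | v ∈ periodicPts g ∧ cycleRoot g v = ρ ∧ cycleHeight g v = κ}.ncard ≤ 2 := by
  have hsub : Set.MapsTo (cycleDist g)
      {v | v ∈ periodicPts g ∧ cycleRoot g v = ρ ∧ cycleHeight g v = κ}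
      ((({κ.toNat, ((minimalPeriod g ρ : ℤ) - κ).toNat} : Finset ℕ)) : Set ℕ) := by
    rintro v ⟨hv, rfl, rfl⟩
    simp only [cycleHeight, minimalPeriod_cycleRoot hv]
    have hle : cycleDist g v < minimalPeriod g v := by
      have hpos := minimalPeriod_pos_of_mem_periodicPts hv
      rcases cycleDist_apply hv with ⟨_, h⟩ | ⟨h0, h⟩
      · rw [← Nat.mod_add_div (cycleDist g v) (minimalPeriod g v)]
        have hmod : g^[cycleDist g v % minimalPeriod g v] v = cycleRoot g v := by
          rw [iterate_mod_minimalPeriod_eq, iterate_cycleDist]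
        have := cycleDist_le g hmod
        have := Nat.mod_lt (cycleDist g v) hpos
        have := Nat.mod_add_div (cycleDist g v) (minimalPeriod g v)
        omega
      · omega
    simp only [Finset.coe_insert, Finset.coe_singleton, Set.mem_insert_iff,
      Set.mem_singleton_iff]
    omega
  refine (Set.ncard_le_ncard_of_injOn (cycleDist g) hsub ?_ (Finset.finite_toSet _)).trans ?_
  · rintro u ⟨hu, hu', -⟩ v ⟨hv, hv', -⟩ h
    exact eq_of_cycleDist_eq hu hv (hu'.trans hv'.symm) h
  · rw [Set.ncard_coe_finset]
    exact Finset.card_le_two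

variable (g)

open Classical in
/-- The address of the `j`-th ancestor of `v` in the forest obtained from the functional graph of
`g` by folding every cycle onto a path that ends in its root, and by continuing this path by
virtual ancestors of the root, which have negative heights. -/
noncomputable def ancestor : ℕ → V → V ⊕ V × ℤ
  | 0, v => if v ∈ periodicPts g then Sum.inr (cycleRoot g v, cycleHeight g v) else Sum.inl v
  | j + 1, v => if v ∈ periodicPts g then Sum.inr (cycleRoot g v, cycleHeight g v - (j + 1 : ℕ))
      else ancestor j (g v)

variable {g}

theorem ancestor_of_mem {v : V} (hv : v ∈ periodicPts g) (j : ℕ) :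
    ancestor g j v = Sum.inr (cycleRoot g v, cycleHeight g v - (j : ℕ)) := by
  cases j <;> simp [ancestor, hv]

theorem ancestor_zero_of_notMem {v : V} (hv : v ∉ periodicPts g) :
    ancestor g 0 v = Sum.inl v := by
  simp [ancestor, hv]

theorem ancestor_succ_of_notMem {v : V} (hv : v ∉ periodicPts g) (j : ℕ) :
    ancestor g (j + 1) v = ancestor g j (g v) := by
  simp [ancestor, hv]

/-- An edge of the functional graph becomes an edge of the de Bruijn graph: off the cycles the
sequence of ancestors is shifted, and on a folded cycle the height changes by at most one. -/
theorem wordAdj_ancestor (v : V) :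
    WordAdj (fun j => ancestor g j v) (fun j => ancestor g j (g v)) := by
  by_cases hv : v ∈ periodicPts g
  · simp only [WordAdj, ancestor_of_mem hv, ancestor_of_mem (apply_mem_periodicPts hv),
      cycleRoot_apply hv]
    rcases cycleHeight_apply hv with h | h | h
    · left
      intro j
      rw [h]; push_cast; simp
    · right; left
      intro j
      rw [h]; push_cast; simp
    · right; right
      rw [h]
  · exact Or.inl fun j => ancestor_succ_of_notMem hv j

theorem eq_iterate_of_ancestor_eq_inl {j : ℕ} {v w : V} (h : ancestor g j v = Sum.inl w) :
    w = g^[j] v := by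
  induction j generalizing v with
  | zero =>
    by_cases hv : v ∈ periodicPts g
    · simp [ancestor_of_mem hv] at h
    · rw [ancestor_zero_of_notMem hv] at h
      simpa using h.symm
  | succ j ih =>
    by_cases hv : v ∈ periodicPts g
    · simp [ancestor_of_mem hv] at h
    · rw [ancestor_succ_of_notMem hv] at h
      exact ih h

/-- The letters in the word of a vertex are read off at distinct addresses, and hence are
independent. -/
theorem ancestor_injective (v : V) : Injective fun j => ancestor g j v := by
  have key : ∀ (i j : ℕ) (v : V), i < j → ancestor g i v ≠ ancestor g j v := by
    intro i
    induction i with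
    | zero =>
      intro j v hj h
      by_cases hv : v ∈ periodicPts g
      · simp only [ancestor_of_mem hv, Sum.inr.injEq, Prod.mk.injEq, true_and] at h
        omega
      · rw [ancestor_zero_of_notMem hv] at h
        exact hv ⟨j, hj, (eq_iterate_of_ancestor_eq_inl h.symm).symm⟩
    | succ i ih =>
      intro j v hj h
      by_cases hv : v ∈ periodicPts g
      · simp only [ancestor_of_mem hv, Sum.inr.injEq, Prod.mk.injEq, true_and] at h
        omega
      · obtain ⟨j, rfl⟩ : ∃ k, j = k + 1 := ⟨j - 1, by omega⟩
        rw [ancestor_succ_of_notMem hv, ancestor_succ_of_notMem hv] at h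
        exact ih j (g v) (by omega) h
  intro i j h
  rcases lt_trichotomy i j with hij | hij | hij
  · exact (key i j v hij h).elim
  · exact hij
  · exact (key j i v hij h.symm).elim

theorem ncard_periodic_ancestor_le [Finite V] (j : ℕ) (z : V ⊕ V × ℤ) :
    {v | v ∈ periodicPts g ∧ ancestor g j v = z}.ncard ≤ 2 := by
  rcases z with w | ⟨ρ, κ⟩
  · have : {v | v ∈ periodicPts g ∧ ancestor g j v = Sum.inl w} = ∅ := by
      ext v
      simp only [Set.mem_ofPred_eq, Set.mem_empty_iff_false, iff_false, not_and]
      intro hv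
      simp [ancestor_of_mem hv]
    simp [this]
  · refine (Set.ncard_le_ncard ?_).trans (ncard_cycleHeight_le (g := g) ρ (κ + j))
    rintro v ⟨hv, h⟩
    simp only [ancestor_of_mem hv, Sum.inr.injEq, Prod.mk.injEq] at h
    exact ⟨hv, h.1, by omega⟩

/-- Few vertices have a given address as their `j`-th ancestor. -/
theorem ncard_ancestor_le [Finite V] {D : ℕ} (hg : ∀ w, {v | g v = w}.ncard ≤ D) (j : ℕ)
    (z : V ⊕ V × ℤ) : {v | ancestor g j v = z}.ncard ≤ 2 * (D + 1) ^ j := by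
  induction j generalizing z with
  | zero =>
    rcases z with w | z
    · refine (Set.ncard_le_ncard (t := {w}) ?_).trans (by simp)
      intro v hv
      simpa using (eq_iterate_of_ancestor_eq_inl hv).symm
    · refine (Set.ncard_le_ncard ?_).trans (ncard_periodic_ancestor_le (g := g) 0 (Sum.inr z))
      intro v hv
      refine ⟨?_, hv⟩
      by_contra h
      have hv' : ancestor g 0 v = Sum.inr z := hv
      simp [ancestor_zero_of_notMem h] at hv'
  | succ j ih =>
    classical
    have := Fintype.ofFinite V
    have hsub : {v | ancestor g (j + 1) v = z} ⊆
        {v | v ∈ periodicPts g ∧ ancestor g (j + 1) v = z} ∪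
          ((Finset.univ.filter fun w => ancestor g j w = z).biUnion
            fun w => Finset.univ.filter fun v => g v = w : Finset V) := by
      intro v hv
      by_cases h : v ∈ periodicPts g
      · exact Or.inl ⟨h, hv⟩
      · right
        have hv' : ancestor g (j + 1) v = z := hv
        rw [ancestor_succ_of_notMem h] at hv'
        simpa using hv'
    have hcard : ((Finset.univ.filter fun w => ancestor g j w = z).biUnion
        fun w => Finset.univ.filter fun v => g v = w).card ≤ 2 * (D + 1) ^ j * D := by
      refine (Finset.card_biUnion_le_card_mul _ _ D fun w _ => ?_).trans
        (Nat.mul_le_mul_right _ ?_)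
      · have := hg w
        rwa [Set.ncard_eq_toFinset_card', Set.toFinset_ofPred] at this
      · have := ih z
        rwa [Set.ncard_eq_toFinset_card', Set.toFinset_ofPred] at this
    have hper := ncard_periodic_ancestor_le (g := g) (j + 1) z
    have h3 := Set.ncard_le_ncard hsub
    have h4 := Set.ncard_union_le {v | v ∈ periodicPts g ∧ ancestor g (j + 1) v = z}
      (((Finset.univ.filter fun w => ancestor g j w = z).biUnion
        fun w => Finset.univ.filter fun v => g v = w : Finset V) : Set V)
    rw [Set.ncard_coe_finset] at h4
    have h5 : 1 ≤ (D + 1) ^ j := Nat.one_le_pow _ _ (by omega)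
    have h6 : 2 * (D + 1) ^ (j + 1) = 2 * (D + 1) ^ j * D + 2 * (D + 1) ^ j := by ring
    omega

end FunctionalGraph

/-! ### Covering the edges by functional graphs -/

section Orientation

open Finset

/-- A square matrix of natural numbers with equal positive row and column sums has a positive
generalised diagonal, by Hall's theorem. -/
theorem exists_perm_pos {X : Type*} [Fintype X] [DecidableEq X] {M : X → X → ℕ} {s : ℕ}
    (hs : 0 < s) (hrow : ∀ x, ∑ y, M x y = s) (hcol : ∀ y, ∑ x, M x y = s) :
    ∃ σ : Equiv.Perm X, ∀ x, 0 < M x (σ x) := by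
  obtain ⟨f, hf, hft⟩ := (all_card_le_biUnion_card_iff_exists_injective
    fun x => univ.filter fun y => 0 < M x y).1 fun A => by
      set B := A.biUnion fun x => univ.filter fun y => 0 < M x y with hB
      refine Nat.le_of_mul_le_mul_right ?_ hs
      calc #A * s = ∑ x ∈ A, ∑ y, M x y := by simp [hrow]
        _ = ∑ x ∈ A, ∑ y ∈ B, M x y := by
          refine sum_congr rfl fun x hx => (sum_subset (subset_univ _) fun y _ hy => ?_).symm
          by_contra h
          exact hy (mem_biUnion.2 ⟨x, hx, by simpa using Nat.pos_of_ne_zero h⟩)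
        _ = ∑ y ∈ B, ∑ x ∈ A, M x y := sum_comm
        _ ≤ ∑ y ∈ B, ∑ x, M x y :=
          sum_le_sum fun y _ => sum_le_sum_of_subset (subset_univ _)
        _ = #B * s := by simp [hcol]
  exact ⟨Equiv.ofBijective f (Finite.injective_iff_bijective.1 hf), fun x => by
    simpa using hft x⟩

/-- A square matrix of natural numbers with all row and column sums equal to `s` is a sum of `s`
permutation matrices. -/
theorem exists_perms_of_sum_eq {X : Type*} [Fintype X] [DecidableEq X] {s : ℕ} {M : X → X → ℕ}
    (hrow : ∀ x, ∑ y, M x y = s) (hcol : ∀ y, ∑ x, M x y = s) :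
    ∃ σ : Fin s → Equiv.Perm X, ∀ x y, M x y = #{i | σ i x = y} := by
  induction s generalizing M with
  | zero =>
    refine ⟨fun i => i.elim0, fun x y => ?_⟩
    simpa using (sum_eq_zero_iff.1 (hrow x)) y (mem_univ y)
  | succ s ih =>
    obtain ⟨τ, hτ⟩ := exists_perm_pos (Nat.succ_pos s) hrow hcol
    have hM : ∀ x y, M x y = (M x y - if τ x = y then 1 else 0) + if τ x = y then 1 else 0 := by
      intro x y
      split_ifs with h
      · have := hτ x
        rw [h] at this
        omega
      · simp
    obtain ⟨σ, hσ⟩ := ih (M := fun x y => M x y - if τ x = y then 1 else 0)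
      (fun x => by
        have h := hrow x
        rw [sum_congr rfl fun y _ => hM x y, sum_add_distrib, sum_ite_eq] at h
        simpa using h)
      (fun y => by
        have h := hcol y
        rw [sum_congr rfl fun x _ => hM x y, sum_add_distrib] at h
        have h1 : ∑ x, (if τ x = y then 1 else 0) = 1 := by
          rw [sum_congr rfl fun x _ => if_congr (Equiv.eq_symm_apply τ).symm rfl rfl]
          simp
        omega)
    refine ⟨Fin.cons τ σ, fun x y => ?_⟩
    rw [hM x y, hσ x y, card_filter, card_filter, Fin.sum_univ_succ, add_comm]
    simp

/-- If every set `F` of edges spans at least `a * |F| / N` vertices, then there are `N` functional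
graphs such that every edge belongs to at least `a` of them. The copies of edges are assigned to
endpoints by Hall's theorem, and the resulting bipartite multigraph between edges and vertices is
edge coloured with `N` colours. -/
theorem exists_functional_cover {V : Type*} [Fintype V] {G : SimpleGraph V} {a N : ℕ}
    (haN : a ≤ N)
    (hG : ∀ F : Finset (Sym2 V), (F : Set (Sym2 V)) ⊆ G.edgeSet →
      a * F.card ≤ N * {v | ∃ e ∈ F, v ∈ e}.ncard) :
    ∃ g : Fin N → V → V, (∀ i v, g i v = v ∨ G.Adj v (g i v)) ∧
      ∀ u v, G.Adj u v → ∃ S : Finset (Fin N), S.card = a ∧ ∀ i ∈ S, g i u = v ∨ g i v = u := by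
  classical
  obtain ⟨f, hf, hft⟩ := (all_card_le_biUnion_card_iff_exists_injective
    fun x : G.edgeSet × Fin a => univ.filter fun y : V × Fin N => y.1 ∈ x.1.1).1 fun A => by
      set F : Finset (Sym2 V) := A.image fun x => x.1.1 with hF
      have hFG : (F : Set (Sym2 V)) ⊆ G.edgeSet := by
        intro e he
        obtain ⟨x, -, rfl⟩ := mem_image.1 (mem_coe.1 he)
        exact x.1.2
      have h1 : #A ≤ a * #F := by
        have : #A ≤ #(F ×ˢ (univ : Finset (Fin a))) :=
          card_le_card_of_injOn (fun x => (x.1.1, x.2))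
            (fun x hx => mem_product.2 ⟨mem_image_of_mem (fun x => x.1.1) hx, mem_univ _⟩)
            (fun x _ y _ h => by
              simp only [Prod.mk.injEq] at h
              exact Prod.ext (Subtype.ext h.1) h.2)
        simpa [card_product, mul_comm] using this
      refine h1.trans ((hG F hFG).trans ?_)
      have h2 : #((univ.filter fun v : V => ∃ e ∈ F, v ∈ e) ×ˢ (univ : Finset (Fin N))) ≤
          #(A.biUnion fun x => univ.filter fun y : V × Fin N => y.1 ∈ x.1.1) := by
        refine card_le_card ?_
        rintro ⟨v, k⟩ hv
        simp only [mem_product, mem_filter, mem_univ, true_and, and_true] at hv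
        obtain ⟨e, he, hve⟩ := hv
        obtain ⟨x, hx, rfl⟩ := mem_image.1 he
        exact mem_biUnion.2 ⟨x, hx, by simpa using hve⟩
      rw [card_product, card_univ, Fintype.card_fin] at h2
      rwa [mul_comm, Set.ncard_eq_toFinset_card', Set.toFinset_ofPred]
  let M : G.edgeSet → V → ℕ := fun e v => #{k : Fin a | (f (e, k)).1 = v}
  have hMrow : ∀ e, ∑ v, M e v = a := by
    intro e
    have := card_eq_sum_card_fiberwise (s := (univ : Finset (Fin a))) (t := (univ : Finset V))
      (f := fun k => (f (e, k)).1) (by simp)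
    simpa using this.symm
  have hMcol : ∀ v, ∑ e, M e v ≤ N := by
    intro v
    have h1 : ∑ e, M e v = #{x : G.edgeSet × Fin a | (f x).1 = v} := by
      simp only [M, card_filter]
      rw [Fintype.sum_prod_type]
    rw [h1]
    have : #{x : G.edgeSet × Fin a | (f x).1 = v} ≤ #(univ : Finset (Fin N)) := by
      refine card_le_card_of_injOn (fun x => (f x).2) (by simp) ?_
      intro x hx y hy h
      simp only [coe_filter, mem_univ, true_and, Set.mem_ofPred_eq] at hx hy
      exact hf (Prod.ext (hx.trans hy.symm) h)
    simpa using this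
  have hMpos : ∀ e v, 0 < M e v → v ∈ e.1 := by
    intro e v h
    obtain ⟨k, hk⟩ := card_pos.1 h
    simp only [mem_filter, mem_univ, true_and] at hk
    have := hft (e, k)
    simp only [mem_filter, mem_univ, true_and] at this
    rwa [hk] at this
  let B : G.edgeSet ⊕ V → G.edgeSet ⊕ V → ℕ
    | .inl e, .inl e' => if e = e' then N - a else 0
    | .inl e, .inr v => M e v
    | .inr v, .inl e => M e v
    | .inr v, .inr v' => if v = v' then N - ∑ e, M e v else 0
  obtain ⟨σ, hσ⟩ := exists_perms_of_sum_eq (M := B) (s := N)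
    (by
      rintro (e | v)
      · simp only [Fintype.sum_sum_type, B, sum_ite_eq, mem_univ, if_true, hMrow]
        omega
      · have := hMcol v
        simp only [Fintype.sum_sum_type, B, sum_ite_eq, mem_univ, if_true]
        omega)
    (by
      rintro (e | v)
      · simp only [Fintype.sum_sum_type, B, sum_ite_eq', mem_univ, if_true, hMrow]
        omega
      · have := hMcol v
        simp only [Fintype.sum_sum_type, B, sum_ite_eq', mem_univ, if_true]
        omega)
  have hmem : ∀ i e v, σ i (Sum.inl e) = Sum.inr v → v ∈ e.1 := by
    intro i e v h
    apply hMpos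
    have := hσ (Sum.inl e) (Sum.inr v)
    simp only [B] at this
    rw [this]
    exact card_pos.2 ⟨i, by simpa using h⟩
  let g : Fin N → V → V := fun i v =>
    Sum.elim (fun e : G.edgeSet => if h : v ∈ e.1 then Sym2.Mem.other h else v) (fun _ => v)
      ((σ i).symm (Sum.inr v))
  have hg : ∀ i e v (h : σ i (Sum.inl e) = Sum.inr v), g i v = Sym2.Mem.other (hmem i e v h) := by
    intro i e v h
    have h' : (σ i).symm (Sum.inr v) = Sum.inl e := by rw [← h, Equiv.symm_apply_apply]
    simp only [g, h', Sum.elim_inl, dif_pos (hmem i e v h)]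
  refine ⟨g, fun i v => ?_, fun u v huv => ?_⟩
  · rcases h : (σ i).symm (Sum.inr v) with e | w
    · have h' : σ i (Sum.inl e) = Sum.inr v := by rw [← h, Equiv.apply_symm_apply]
      right
      rw [hg i e v h']
      have := e.2
      rw [← Sym2.other_spec (hmem i e v h')] at this
      exact G.mem_edgeSet.1 this
    · left
      simp [g, h]
  · set e : G.edgeSet := ⟨s(u, v), huv⟩ with he
    refine ⟨univ.filter fun i => ∃ w, σ i (Sum.inl e) = Sum.inr w, ?_, ?_⟩
    · rw [← hMrow e]
      have hbi : (univ.filter fun i => ∃ w, σ i (Sum.inl e) = Sum.inr w) =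
          (univ : Finset V).biUnion fun w => univ.filter fun i => σ i (Sum.inl e) = Sum.inr w := by
        ext i
        simp
      rw [hbi, card_biUnion]
      · refine sum_congr rfl fun w _ => ?_
        exact (hσ (Sum.inl e) (Sum.inr w)).symm
      · intro w _ w' _ hne
        rw [Function.onFun, disjoint_left]
        intro i hi hi'
        simp only [mem_filter, mem_univ, true_and] at hi hi'
        rw [hi] at hi'
        exact hne (Sum.inr_injective hi')
    · intro i hi
      simp only [mem_filter, mem_univ, true_and] at hi
      obtain ⟨w, hw⟩ := hi
      have h1 := hg i e w hw
      have h2 := Sym2.other_spec (hmem i e w hw)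
      rw [← h1] at h2
      have h3 : s(w, g i w) = s(u, v) := h2
      rcases Sym2.eq_iff.1 h3 with ⟨rfl, h⟩ | ⟨rfl, h⟩
      · exact Or.inl h
      · exact Or.inr h

end Orientation

/-! ### Random letters with few dependencies -/

section RandomLetters

open Finset

/-- Greedy colouring with more colours than the maximum degree. -/
theorem exists_coloring_of_degree_lt {V : Type*} [Fintype V] {H : SimpleGraph V} {D : ℕ}
    (hH : ∀ v, (H.neighborSet v).ncard < D) : ∃ κ : V → Fin D, ∀ u v, H.Adj u v → κ u ≠ κ v := by
  classical
  rcases isEmpty_or_nonempty V with hV | ⟨⟨v₀⟩⟩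
  · exact ⟨fun v => hV.elim v, fun v => hV.elim v⟩
  have : NeZero D := ⟨by have := hH v₀; omega⟩
  suffices h : ∀ s : Finset V, ∃ κ : V → Fin D, ∀ u ∈ s, ∀ v ∈ s, H.Adj u v → κ u ≠ κ v by
    obtain ⟨κ, hκ⟩ := h univ
    exact ⟨κ, fun u v => hκ u (mem_univ _) v (mem_univ _)⟩
  intro s
  induction s using Finset.induction_on with
  | empty => exact ⟨fun _ => 0, by simp⟩
  | insert v s hv ih =>
    obtain ⟨κ, hκ⟩ := ih
    obtain ⟨c, hc⟩ : ∃ c, c ∉ κ '' H.neighborSet v := by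
      by_contra! h
      have h1 : (Set.univ : Set (Fin D)) ⊆ κ '' H.neighborSet v := fun c _ => h c
      have h2 := (Set.ncard_le_ncard h1).trans (Set.ncard_image_le (Set.toFinite _))
      have h3 := hH v
      simp only [Set.ncard_univ, Nat.card_eq_fintype_card, Fintype.card_fin] at h2
      omega
    have hc' : ∀ u, H.Adj v u → κ u ≠ c := fun u hu h => hc ⟨u, hu, h⟩
    have hne : ∀ u ∈ s, u ≠ v := fun u hu h => hv (h ▸ hu)
    refine ⟨Function.update κ v c, fun u hu w hw huw => ?_⟩
    rcases mem_insert.1 hu with rfl | hus <;> rcases mem_insert.1 hw with rfl | hws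
    · exact (H.loopless.irrefl _ huw).elim
    · rw [Function.update_self, Function.update_of_ne (hne w hws)]
      exact (hc' w huw).symm
    · rw [Function.update_self, Function.update_of_ne (hne u hus)]
      exact hc' u huw.symm
    · rw [Function.update_of_ne (hne u hus), Function.update_of_ne (hne w hws)]
      exact hκ u hus w hws huw

/-- The binomial tail bound in the form needed here: `q` is at least `6` times the mean `s / p`. -/
theorem choose_mul_two_pow_le {s p q : ℕ} (h : 6 * s ≤ p * q) : s.choose q * 2 ^ q ≤ p ^ q := by
  have h1 : q ^ q ≤ 3 ^ q * q.factorial := by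
    have h2 : ((q : ℝ) ^ q) / q.factorial ≤ Real.exp q :=
      Real.pow_div_factorial_le_exp _ (Nat.cast_nonneg _) _
    have h3 : Real.exp q ≤ 3 ^ q := by
      rw [← Real.exp_one_pow]
      exact pow_le_pow_left₀ (Real.exp_pos _).le (by have := Real.exp_one_lt_d9; linarith) _
    rw [div_le_iff₀ (by positivity)] at h2
    have h4 : (q : ℝ) ^ q ≤ 3 ^ q * q.factorial :=
      h2.trans (mul_le_mul_of_nonneg_right h3 (by positivity))
    exact_mod_cast h4
  have h2 : s.choose q * q.factorial ≤ s ^ q := by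
    rw [mul_comm, ← Nat.descFactorial_eq_factorial_mul_choose]
    exact Nat.descFactorial_le_pow s q
  have h3 : (6 * s) ^ q ≤ (p * q) ^ q := Nat.pow_le_pow_left h q
  have h4 : 0 < 3 ^ q * q.factorial := by positivity
  refine Nat.le_of_mul_le_mul_right ?_ h4
  calc s.choose q * 2 ^ q * (3 ^ q * q.factorial) = (2 * 3) ^ q * (s.choose q * q.factorial) := by
        rw [mul_pow]; ring
    _ ≤ 6 ^ q * s ^ q := Nat.mul_le_mul_left _ h2
    _ = (6 * s) ^ q := (mul_pow _ _ _).symm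
    _ ≤ (p * q) ^ q := h3
    _ = p ^ q * q ^ q := mul_pow _ _ _
    _ ≤ p ^ q * (3 ^ q * q.factorial) := Nat.mul_le_mul_left _ h1

/-- The number of functions that agree with given functions on pairwise disjoint ranges. -/
theorem card_filter_agree_mul_le {V ι Z : Type*} [Fintype ι] [Fintype Z] [DecidableEq Z] {r : ℕ}
    {pos : V → ι → Z} (hpos : ∀ v, Function.Injective (pos v)) (Q : Finset V)
    (hQ : ∀ u ∈ Q, ∀ v ∈ Q, u ≠ v → ∀ k l, pos u k ≠ pos v l) (x : ι → Fin r) :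
    #{ω : Z → Fin r | ∀ v ∈ Q, ∀ k, ω (pos v k) = x k} * (r ^ Fintype.card ι) ^ #Q ≤
      Fintype.card (Z → Fin r) := by
  classical
  set T : Finset Z := (Q ×ˢ (univ : Finset ι)).image fun y => pos y.1 y.2 with hT
  have hTcard : #T = Fintype.card ι * #Q := by
    rw [hT, card_image_of_injOn, card_product, card_univ, mul_comm]
    rintro ⟨u, k⟩ hu ⟨v, l⟩ hv h
    simp only [coe_product, coe_univ, Set.mem_prod, Set.mem_univ, and_true, mem_coe] at hu hv
    by_cases huv : u = v
    · subst huv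
      rw [hpos u (a₁ := k) (a₂ := l) h]
    · exact (hQ u hu v hv huv k l h).elim
  have hE : #{ω : Z → Fin r | ∀ v ∈ Q, ∀ k, ω (pos v k) = x k} ≤
      Fintype.card ({z // z ∉ T} → Fin r) := by
    rw [← card_univ]
    refine card_le_card_of_injOn (fun ω z => ω z.1) (by simp) ?_
    intro ω hω ω' hω' h
    simp only [coe_filter, mem_univ, true_and, Set.mem_ofPred_eq] at hω hω'
    funext z
    by_cases hz : z ∈ T
    · obtain ⟨⟨v, k⟩, hvk, rfl⟩ := mem_image.1 hz
      have hv := (mem_product.1 hvk).1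
      exact (hω v hv k).trans (hω' v hv k).symm
    · exact congr_fun h ⟨z, hz⟩
  refine (Nat.mul_le_mul_right _ hE).trans ?_
  rw [Fintype.card_fun, Fintype.card_fun, Fintype.card_fin, Fintype.card_subtype_compl,
    Fintype.card_coe, ← pow_mul, ← hTcard, ← pow_add,
    Nat.sub_add_cancel (card_le_univ T)]

/-- The case of finitely many positions of `exists_letters`, where letters can be counted. -/
theorem exists_letters_of_fintype {V ι Z : Type*} [Fintype V] [Fintype ι] [Fintype Z]
    {r D L : ℕ} (hr : 0 < r) {pos : V → ι → Z} (hpos : ∀ v, Function.Injective (pos v))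
    (hD : ∀ v, {u | u ≠ v ∧ ∃ k l, pos u k = pos v l}.ncard < D)
    (hL : D * r ^ Fintype.card ι ≤ 2 ^ L) :
    ∃ ω : Z → Fin r, ∀ x : ι → Fin r,
      {u | ∀ k, ω (pos u k) = x k}.ncard ≤ 6 * Fintype.card V / r ^ Fintype.card ι + D * L := by
  classical
  set p := r ^ Fintype.card ι with hp
  have hp0 : 0 < p := pow_pos hr _
  let H : SimpleGraph V :=
    { Adj := fun u v => u ≠ v ∧ ∃ k l, pos u k = pos v l
      symm := ⟨fun u v h => ⟨h.1.symm, let ⟨k, l, h'⟩ := h.2; ⟨l, k, h'.symm⟩⟩⟩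
      loopless := ⟨fun v h => h.1 rfl⟩ }
  obtain ⟨κ, hκ⟩ := exists_coloring_of_degree_lt (H := H) (D := D) fun v => by
    refine lt_of_eq_of_lt ?_ (hD v)
    congr 1
    ext u
    exact H.adj_comm v u
  let S : Fin D → Finset V := fun c => univ.filter fun v => κ v = c
  -- a fibre is bad if it contains `q c` vertices of the class `c`
  let q : Fin D → ℕ := fun c => 6 * #(S c) / p + L + 1
  have hq : ∀ c, 6 * #(S c) ≤ p * q c := by
    intro c
    have h1 := Nat.div_add_mod (6 * #(S c)) p
    have h2 := Nat.mod_lt (6 * #(S c)) hp0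
    simp only [q]
    nlinarith
  let E : (ι → Fin r) → Finset V → Finset (Z → Fin r) := fun x Q =>
    univ.filter fun ω => ∀ v ∈ Q, ∀ k, ω (pos v k) = x k
  have hE : ∀ c x, 2 ^ (L + 1) * ∑ Q ∈ powersetCard (q c) (S c), #(E x Q) ≤
      Fintype.card (Z → Fin r) := by
    intro c x
    have h1 : ∀ Q ∈ powersetCard (q c) (S c), #(E x Q) * p ^ q c ≤ Fintype.card (Z → Fin r) := by
      intro Q hQ
      rw [mem_powersetCard] at hQ
      rw [← hQ.2]
      refine le_of_eq_of_le ?_ (card_filter_agree_mul_le hpos Q ?_ x)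
      · simp only [E, p]
        congr!
      intro u hu v hv huv k l h
      have hu' : κ u = c := by simpa [S] using hQ.1 hu
      have hv' : κ v = c := by simpa [S] using hQ.1 hv
      exact hκ u v ⟨huv, k, l, h⟩ (hu'.trans hv'.symm)
    have h2 := choose_mul_two_pow_le (hq c)
    have h3 : (∑ Q ∈ powersetCard (q c) (S c), #(E x Q)) * p ^ q c ≤
        (#(S c)).choose (q c) * Fintype.card (Z → Fin r) := by
      rw [sum_mul]
      refine (sum_le_card_nsmul _ _ _ h1).trans ?_
      rw [card_powersetCard, smul_eq_mul]
    have h4 : 2 ^ (L + 1) ≤ 2 ^ q c :=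
      Nat.pow_le_pow_right (by norm_num) (Nat.succ_le_succ (Nat.le_add_left _ _))
    refine Nat.le_of_mul_le_mul_right ?_ (pow_pos hp0 (q c))
    calc 2 ^ (L + 1) * (∑ Q ∈ powersetCard (q c) (S c), #(E x Q)) * p ^ q c
        ≤ 2 ^ q c * ((∑ Q ∈ powersetCard (q c) (S c), #(E x Q)) * p ^ q c) := by
          rw [mul_assoc]; exact Nat.mul_le_mul_right _ h4
      _ ≤ 2 ^ q c * ((#(S c)).choose (q c) * Fintype.card (Z → Fin r)) :=
          Nat.mul_le_mul_left _ h3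
      _ = (#(S c)).choose (q c) * 2 ^ q c * Fintype.card (Z → Fin r) := by ring
      _ ≤ p ^ q c * Fintype.card (Z → Fin r) := Nat.mul_le_mul_right _ h2
      _ = Fintype.card (Z → Fin r) * p ^ q c := mul_comm _ _
  let bad : Finset (Z → Fin r) := univ.biUnion fun cx : Fin D × (ι → Fin r) =>
    (powersetCard (q cx.1) (S cx.1)).biUnion fun Q => E cx.2 Q
  have : NeZero r := ⟨hr.ne'⟩
  have hΩ : 0 < Fintype.card (Z → Fin r) := Fintype.card_pos
  have hbad : #bad < Fintype.card (Z → Fin r) := by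
    have h1 : #bad ≤ ∑ cx : Fin D × (ι → Fin r), ∑ Q ∈ powersetCard (q cx.1) (S cx.1),
        #(E cx.2 Q) :=
      card_biUnion_le.trans (sum_le_sum fun cx _ => card_biUnion_le)
    have h2 : 2 ^ (L + 1) * #bad ≤ 2 ^ L * Fintype.card (Z → Fin r) := by
      refine (Nat.mul_le_mul_left _ h1).trans ?_
      rw [mul_sum]
      refine (sum_le_card_nsmul _ _ _ fun cx _ => hE cx.1 cx.2).trans ?_
      rw [smul_eq_mul, card_univ, Fintype.card_prod, Fintype.card_fin, Fintype.card_fun,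
        Fintype.card_fin]
      exact Nat.mul_le_mul_right _ hL
    have h3 : 2 * #bad ≤ Fintype.card (Z → Fin r) := by
      refine Nat.le_of_mul_le_mul_left ?_ (pow_pos (by norm_num : 0 < 2) L)
      rw [pow_succ, mul_assoc] at h2
      exact h2
    omega
  obtain ⟨ω, hω⟩ : ∃ ω, ω ∉ bad := by
    by_contra! h
    rw [eq_univ_of_forall h, card_univ] at hbad
    exact lt_irrefl _ hbad
  refine ⟨ω, fun x => ?_⟩
  have hclass : ∀ c, #((univ.filter fun u => ∀ k, ω (pos u k) = x k).filter fun u => κ u = c) ≤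
      6 * #(S c) / p + L := by
    intro c
    by_contra! h
    obtain ⟨Q, hQ, hQc⟩ := exists_subset_card_eq (Nat.succ_le_of_lt h)
    refine hω (mem_biUnion.2 ⟨(c, x), mem_univ _, mem_biUnion.2 ⟨Q, mem_powersetCard.2
      ⟨fun u hu => ?_, hQc⟩, mem_filter.2 ⟨mem_univ _, fun u hu => ?_⟩⟩⟩)
    · have := hQ hu
      simp only [mem_filter, mem_univ, true_and] at this
      simpa [S] using this.2
    · have := hQ hu
      simp only [mem_filter, mem_univ, true_and] at this
      exact this.1
  rw [Set.ncard_eq_toFinset_card', Set.toFinset_ofPred,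
    card_eq_sum_card_fiberwise (t := (univ : Finset (Fin D))) (f := κ) (by simp)]
  refine (sum_le_sum fun c _ => hclass c).trans ?_
  rw [sum_add_distrib]
  refine Nat.add_le_add ?_ (by simp)
  rw [Nat.le_div_iff_mul_le hp0, sum_mul]
  refine (sum_le_sum fun c _ => Nat.div_mul_le_self _ _).trans ?_
  rw [← mul_sum, ← card_univ, card_eq_sum_card_fiberwise (t := (univ : Finset (Fin D)))
    (f := κ) (by simp)]

/-- Random letters at the positions `Z`: if every vertex shares positions with fewer than `D`
others, then the words read off by the vertices are equidistributed up to a constant factor and an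
additive error. The vertices are split into `D` classes in which the words are independent, and
the union bound is applied to each class and each word. -/
theorem exists_letters {V ι Z : Type*} [Fintype V] [Fintype ι]
    {r D L : ℕ} (hr : 0 < r) {pos : V → ι → Z} (hpos : ∀ v, Function.Injective (pos v))
    (hD : ∀ v, {u | u ≠ v ∧ ∃ k l, pos u k = pos v l}.ncard < D)
    (hL : D * r ^ Fintype.card ι ≤ 2 ^ L) :
    ∃ ω : Z → Fin r, ∀ x : ι → Fin r,
      {u | ∀ k, ω (pos u k) = x k}.ncard ≤ 6 * Fintype.card V / r ^ Fintype.card ι + D * L := by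
  classical
  let T : Finset Z := univ.image fun y : V × ι => pos y.1 y.2
  have hT : ∀ v k, pos v k ∈ T := fun v k => mem_image.2 ⟨(v, k), mem_univ _, rfl⟩
  obtain ⟨ω, hω⟩ := exists_letters_of_fintype (Z := T) hr (pos := fun v k => ⟨pos v k, hT v k⟩)
    (D := D) (L := L) (fun v k l h => hpos v (Subtype.ext_iff.1 h))
    (by simpa only [Subtype.mk.injEq] using hD) hL
  refine ⟨fun z => if h : z ∈ T then ω ⟨z, h⟩ else ⟨0, hr⟩, fun x => ?_⟩
  simpa [hT] using hω x

end RandomLetters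

/-! ### The twin-width bound for all parameters -/

section Combine

open Finset

theorem WordAdj.symm {α : Type*} {x y : ℕ → α} (h : WordAdj x y) : WordAdj y x := by
  rcases h with h | h | h
  · exact Or.inr (Or.inl h)
  · exact Or.inl h
  · exact Or.inr (Or.inr h.symm)

theorem WordAdj.map {α β : Type*} {x y : ℕ → α} (h : WordAdj x y) (f : α → β) :
    WordAdj (fun j => f (x j)) (fun j => f (y j)) := by
  rcases h with h | h | h
  · exact Or.inl fun j => congrArg f (h j)
  · exact Or.inr (Or.inl fun j => congrArg f (h j))
  · exact Or.inr (Or.inr (funext fun j => congrArg f (congr_fun h j)))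

/-- A strict upper bound for the number of vertices whose words of length `t` share an address with
those of a given vertex, in graphs of maximum degree at most `Δ`. -/
def dependencyBound (N t Δ : ℕ) : ℕ := N * t * t * (2 * (Δ + 2) ^ t) + 1

theorem ncard_dependent_lt {V : Type*} [Fintype V] {G : SimpleGraph V} {N t Δ : ℕ}
    (hΔ : ∀ v, (G.neighborSet v).ncard ≤ Δ) {g : Fin N → V → V}
    (hg : ∀ i v, g i v = v ∨ G.Adj v (g i v)) (v : V) :
    {u | u ≠ v ∧ ∃ k l : Fin N × Fin t,
      (k.1, ancestor (g k.1) k.2 u) = (l.1, ancestor (g l.1) l.2 v)}.ncard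
        < dependencyBound N t Δ := by
  classical
  have hfib : ∀ i w, {u | g i u = w}.ncard ≤ Δ + 1 := by
    intro i w
    refine (Set.ncard_le_ncard (t := insert w (G.neighborSet w)) ?_).trans
      ((Set.ncard_insert_le _ _).trans (Nat.succ_le_succ (hΔ w)))
    rintro u rfl
    rcases hg i u with h | h
    · exact Or.inl h.symm
    · exact Or.inr h.symm
  let F : Fin N × Fin t × Fin t → Finset V := fun y =>
    univ.filter fun u => ancestor (g y.1) y.2.1 u = ancestor (g y.1) y.2.2 v
  have hF : ∀ y ∈ (univ : Finset (Fin N × Fin t × Fin t)), #(F y) ≤ 2 * (Δ + 2) ^ t := by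
    intro y _
    have h1 := ncard_ancestor_le (hfib y.1) y.2.1 (ancestor (g y.1) y.2.2 v)
    rw [Set.ncard_eq_toFinset_card', Set.toFinset_ofPred] at h1
    refine h1.trans (Nat.mul_le_mul_left _ (Nat.pow_le_pow_right (by omega) y.2.1.2.le))
  have hcard : #(univ.biUnion F) ≤ N * t * t * (2 * (Δ + 2) ^ t) := by
    refine (card_biUnion_le_card_mul _ _ _ hF).trans (le_of_eq ?_)
    simp [mul_assoc]
  refine Nat.lt_succ_of_le (le_trans ?_ hcard)
  rw [← Set.ncard_coe_finset]
  refine Set.ncard_le_ncard ?_ (Finset.finite_toSet _)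
  rintro u ⟨-, ⟨i, j⟩, ⟨i', j'⟩, h⟩
  simp only [Prod.mk.injEq] at h
  obtain ⟨rfl, h⟩ := h
  exact mem_coe.2 (mem_biUnion.2 ⟨(i, j, j'), mem_univ _, by simpa [F] using h⟩)

/-- The twin-width bound for all choices of the parameters: `N` functional graphs that cover each
edge `a` times, an alphabet of size `r` and words of length `t`. -/
theorem tww_le_of_density {V : Type*} [Fintype V] {G : SimpleGraph V} {a N t r Δ L : ℕ}
    (haN : a ≤ N) (hr : 0 < r) (hΔ : ∀ v, (G.neighborSet v).ncard ≤ Δ)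
    (hG : ∀ F : Finset (Sym2 V), (F : Set (Sym2 V)) ⊆ G.edgeSet →
      a * F.card ≤ N * {v | ∃ e ∈ F, v ∈ e}.ncard)
    (hL : dependencyBound N t Δ * r ^ (N * t) ≤ 2 ^ L) :
    tww G ≤ max ((6 * Fintype.card V / r ^ (N * t) + dependencyBound N t Δ * L) * Δ)
      (r * wordDegree N a r t) := by
  obtain ⟨g, hg, hcover⟩ := exists_functional_cover haN hG
  have hcard : Fintype.card (Fin N × Fin t) = N * t := by simp
  obtain ⟨ω, hω⟩ := exists_letters (ι := Fin N × Fin t) hr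
    (pos := fun v k => (k.1, ancestor (g k.1) k.2 v)) (D := dependencyBound N t Δ) (L := L)
    (by
      rintro v ⟨i, j⟩ ⟨i', j'⟩ h
      simp only [Prod.mk.injEq] at h
      obtain ⟨rfl, h⟩ := h
      rw [Fin.ext (ancestor_injective v h)])
    (ncard_dependent_lt hΔ hg) (by rwa [hcard])
  rw [hcard] at hω
  refine tww_le_of_words hr (L := fun v i j => ω (i, ancestor (g i) j v)) ?_ ?_ hΔ
  · intro u v huv
    obtain ⟨S, hS, hSg⟩ := hcover u v huv
    refine ⟨S, hS, fun i hi => ?_⟩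
    rcases hSg i hi with h | h
    · rw [← h]
      exact (wordAdj_ancestor u).map fun z => ω (i, z)
    · rw [← h]
      exact ((wordAdj_ancestor v).map fun z => ω (i, z)).symm
  · intro v
    refine le_of_eq_of_le ?_ (hω fun k => ω (k.1, ancestor (g k.1) k.2 v))
    congr 1
    ext u
    constructor
    · exact fun h k => h k.1 k.2 k.2.2
    · exact fun h i j hj => h (i, ⟨j, hj⟩)

/-- Independent uniform binary words, one for each vertex, give a bound that is best for graphs of
large degree. -/
theorem tww_le_of_binary_words {V : Type*} [Fintype V] {G : SimpleGraph V} {t Δ : ℕ}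
    (hΔ : ∀ v, (G.neighborSet v).ncard ≤ Δ) :
    tww G ≤ max ((6 * Fintype.card V / 2 ^ t + t) * Δ) (2 * 2 ^ t) := by
  obtain ⟨ω, hω⟩ := exists_letters (ι := Fin t) (r := 2) (D := 1) (L := t) (by norm_num)
    (pos := fun (v : V) (k : Fin t) => (v, (k : ℕ)))
    (by
      intro v k l h
      simpa [Fin.ext_iff] using h)
    (by
      intro v
      have : {u | u ≠ v ∧ ∃ k l : Fin t, (u, (k : ℕ)) = (v, (l : ℕ))} = ∅ := by
        ext u
        simp only [Prod.mk.injEq, Set.mem_ofPred_eq, Set.mem_empty_iff_false, iff_false]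
        rintro ⟨h, k, l, h', -⟩
        exact h h'
      rw [this]
      simp)
    (by simp)
  rw [Fintype.card_fin, one_mul] at hω
  have := tww_le_of_words (G := G) (N := 1) (a := 0) (t := t) (r := 2) (by norm_num)
    (B := 6 * Fintype.card V / 2 ^ t + t) (Δ := Δ) (L := fun v _ j => ω (v, j))
    (fun u v _ => ⟨∅, rfl, by simp⟩)
    (by
      intro v
      refine le_of_eq_of_le ?_ (hω fun k => ω (v, k))
      congr 1
      ext u
      constructor
      · exact fun h k => h 0 k k.2
      · exact fun h i j hj => h ⟨j, hj⟩) hΔ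
  simpa [wordDegree] using this

end Combine

/-! ### The choice of parameters -/

section Numerics

open Real

/-- The error term in the exponent of `upperBound`, as a function of `ℓ = log n`. -/
noncomputable def errorTerm (ℓ d : ℝ) : ℝ := d⁻¹ * √ℓ * log ℓ + log d

theorem upperBound_eq_exp {C : ℝ} {n : ℕ} {d : ℝ} (hn : 0 < n) :
    upperBound C n d = exp (log n * ((d - 2) / (2 * d - 2)) + C * errorTerm (log n) d) := by
  rw [upperBound, rpow_def_of_pos (by exact_mod_cast hn), ← exp_add, errorTerm]

theorem errorTerm_nonneg {ℓ d : ℝ} (hℓ : 1 ≤ ℓ) (hd : 1 ≤ d) : 0 ≤ errorTerm ℓ d := by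
  have := log_nonneg hℓ
  have := log_nonneg hd
  unfold errorTerm
  positivity

theorem one_le_log_of_le {ℓ : ℝ} (hℓ : 16 ≤ ℓ) : 1 ≤ log ℓ := by
  rw [le_log_iff_exp_le (by linarith)]
  have := exp_one_lt_d9
  linarith

/-- Powers of `log n` are absorbed by the error term. -/
theorem log_le_two_mul_errorTerm {ℓ d : ℝ} (hℓ : 16 ≤ ℓ) (hd : 1 ≤ d) :
    log ℓ ≤ 2 * errorTerm ℓ d := by
  have h1 := one_le_log_of_le hℓ
  have hd0 := log_nonneg hd
  unfold errorTerm
  rcases le_total d (√ℓ) with h | h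
  · have h2 : 1 ≤ d⁻¹ * √ℓ := by
      rw [inv_mul_eq_div, le_div_iff₀ (by linarith)]; linarith
    nlinarith
  · have h2 : log (√ℓ) ≤ log d := log_le_log (sqrt_pos.2 (by linarith)) h
    rw [log_sqrt (by linarith)] at h2
    have h3 : 0 ≤ d⁻¹ * √ℓ * log ℓ := by positivity
    linarith

theorem log_le_errorTerm {ℓ d : ℝ} (hℓ : 1 ≤ ℓ) (hd : 1 ≤ d) : log d ≤ errorTerm ℓ d := by
  have := log_nonneg hℓ
  unfold errorTerm
  have : 0 ≤ d⁻¹ * √ℓ * log ℓ := by positivity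
  linarith

/-- The covering numbers `a` and `N`, the word length `t`, and a real alphabet size `exp y` for which
the number of words `exp (N * t * y)` is exactly `n ^ (d / (2 * d - 2))`. The length is chosen such
that the alphabet size lies between a power of `log n` and its square. -/
theorem exists_parameters {ℓ d : ℝ} {A : ℕ} (hℓ : 16 ≤ ℓ) (hA : 1 ≤ A) (hd : 2 < d)
    (hsqrt : 4 * A * log ℓ * √ℓ ≤ ℓ) (hdℓ : 2 * A * d * log ℓ ≤ ℓ) :
    ∃ (a N t : ℕ) (y : ℝ), 1 ≤ a ∧ a ≤ N ∧ 1 ≤ t ∧ a * d ≤ 2 * N ∧ 2 * N ≤ a * d + 2 ∧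
      √ℓ ≤ a * d ∧ a * d ≤ √ℓ + d ∧
      N * t * y = ℓ * (d / (2 * d - 2)) ∧ A * log ℓ ≤ y ∧ y ≤ 2 * (A * log ℓ) := by
  have hlog := one_le_log_of_le hℓ
  have hs : 0 < √ℓ := sqrt_pos.2 (by linarith)
  have hs4 : 4 ≤ √ℓ := le_sqrt_of_sq_le (by linarith)
  have hA' : (1 : ℝ) ≤ A := by exact_mod_cast hA
  have hd0 : 0 < d := by linarith
  set a := ⌈√ℓ / d⌉₊ with ha
  have ha1 : 1 ≤ a := Nat.one_le_ceil_iff.2 (by positivity)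
  have ha1' : (1 : ℝ) ≤ a := by exact_mod_cast ha1
  have hsa : √ℓ ≤ a * d := (div_le_iff₀ hd0).1 (Nat.le_ceil _)
  have has : a * d ≤ √ℓ + d := by
    have := (Nat.ceil_lt_add_one (show 0 ≤ √ℓ / d by positivity)).le
    calc (a : ℝ) * d ≤ (√ℓ / d + 1) * d := mul_le_mul_of_nonneg_right this hd0.le
      _ = √ℓ + d := by field_simp
  set N := ⌈(a : ℝ) * d / 2⌉₊ with hN
  have hN1 : a * d ≤ 2 * N := by
    have := Nat.le_ceil ((a : ℝ) * d / 2)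
    linarith
  have hN2 : 2 * N ≤ a * d + 2 := by
    have := (Nat.ceil_lt_add_one (show 0 ≤ (a : ℝ) * d / 2 by positivity)).le
    linarith
  have haN : a ≤ N := by
    have : (a : ℝ) ≤ N := by nlinarith
    exact_mod_cast this
  have hN0 : (1 : ℝ) ≤ N := ha1'.trans (by exact_mod_cast haN)
  set lam : ℝ := A * log ℓ with hlam
  have hlam1 : 1 ≤ lam := by nlinarith
  set Y : ℝ := ℓ * (d / (2 * d - 2)) with hY
  have hY2 : ℓ / 2 ≤ Y := by
    have : 1 / 2 ≤ d / (2 * d - 2) := by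
      rw [div_le_div_iff₀ (by norm_num) (by linarith)]; linarith
    rw [hY]
    nlinarith
  have hNlam : 0 < N * lam := by positivity
  have hone : 1 ≤ Y / (N * lam) := by
    rw [le_div_iff₀ hNlam, one_mul]
    refine le_trans ?_ hY2
    have h1 : 2 * (N * lam) ≤ (√ℓ + d + 2) * lam := by nlinarith
    have h2 : 4 * (lam * √ℓ) ≤ ℓ := by rw [hlam]; nlinarith
    have h3 : 2 * (lam * d) ≤ ℓ := by rw [hlam]; nlinarith
    nlinarith
  set t := ⌊Y / (N * lam)⌋₊ with ht
  have ht1 : 1 ≤ t := Nat.le_floor (by exact_mod_cast hone)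
  have ht1' : (1 : ℝ) ≤ t := by exact_mod_cast ht1
  have htle : t * (N * lam) ≤ Y := (le_div_iff₀ hNlam).1 (Nat.floor_le (by linarith))
  have htgt : Y < (t + 1) * (N * lam) := (div_lt_iff₀ hNlam).1 (Nat.lt_floor_add_one _)
  have hNt : (0 : ℝ) < N * t := by positivity
  refine ⟨a, N, t, Y / (N * t), ha1, haN, ht1, hN1, hN2, hsa, has, ?_, ?_, ?_⟩
  · field_simp
  · rw [le_div_iff₀ hNt]; linarith
  · rw [div_le_iff₀ hNt]; nlinarith

theorem dependencyBound_le {ℓ y : ℝ} {A N t Δ : ℕ} (hℓ : 16 ≤ ℓ) (hA : 1 ≤ A) (hN : 1 ≤ N)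
    (hy : A * log ℓ ≤ y) (hNty : N * t * y ≤ ℓ) (hΔ : (Δ : ℝ) + 2 ≤ ℓ ^ 4) :
    (dependencyBound N t Δ : ℝ) ≤ 3 * ℓ ^ 2 * exp (4 * ℓ / A) := by
  have hlog := one_le_log_of_le hℓ
  have hA' : (1 : ℝ) ≤ A := by exact_mod_cast hA
  have hN' : (1 : ℝ) ≤ N := by exact_mod_cast hN
  have hAl : 1 ≤ A * log ℓ := by nlinarith
  have hNt : (N : ℝ) * t ≤ ℓ :=
    le_trans (le_mul_of_one_le_right (by positivity) (hAl.trans hy)) hNty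
  have ht : (t : ℝ) ≤ N * t := le_mul_of_one_le_left (by positivity) hN'
  have htl : (t : ℝ) * log ℓ ≤ ℓ / A := by
    rw [le_div_iff₀ (by linarith)]
    calc (t : ℝ) * log ℓ * A = t * (A * log ℓ) := by ring
      _ ≤ N * t * y := mul_le_mul ht hy (by linarith) (by positivity)
      _ ≤ ℓ := hNty
  have hpow : ((Δ : ℝ) + 2) ^ t ≤ exp (4 * ℓ / A) := by
    calc ((Δ : ℝ) + 2) ^ t ≤ (ℓ ^ 4) ^ t := pow_le_pow_left₀ (by positivity) hΔ t
      _ = exp (4 * (t * log ℓ)) := by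
        rw [← pow_mul, ← exp_log (show 0 < ℓ by linarith), ← exp_nat_mul, log_exp]
        congr 1
        push_cast
        ring
      _ ≤ exp (4 * ℓ / A) := exp_le_exp.2 (by rw [mul_div_assoc]; linarith)
  have hexp : 1 ≤ exp (4 * ℓ / A) := one_le_exp (by positivity)
  have hNtt : (N : ℝ) * t * t ≤ ℓ ^ 2 := by
    rw [sq]
    exact mul_le_mul hNt (ht.trans hNt) (by positivity) (by linarith)
  have h1 : (1 : ℝ) ≤ ℓ ^ 2 * exp (4 * ℓ / A) := by nlinarith
  rw [dependencyBound]
  push_cast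
  have h2 : (N : ℝ) * t * t * (2 * ((Δ : ℝ) + 2) ^ t) ≤ ℓ ^ 2 * (2 * exp (4 * ℓ / A)) :=
    mul_le_mul hNtt (by linarith) (by positivity) (by positivity)
  linarith

/-- Rounding the alphabet size down changes the number of words by a constant factor only. -/
theorem floor_exp_pow_bounds {ℓ y : ℝ} {M : ℕ} (hℓ : 2 ≤ ℓ) (hy : log ℓ ≤ y) (hM : (M : ℝ) ≤ ℓ) :
    0 < ⌊exp y⌋₊ ∧ (⌊exp y⌋₊ : ℝ) ≤ exp y ∧ exp (M * y - 2) ≤ (⌊exp y⌋₊ : ℝ) ^ M := by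
  have hexp : ℓ ≤ exp y := (log_le_iff_le_exp (by linarith)).1 hy
  have hle : (⌊exp y⌋₊ : ℝ) ≤ exp y := Nat.floor_le (exp_pos y).le
  have hlt : exp y - 1 ≤ ⌊exp y⌋₊ := (Nat.sub_one_lt_floor _).le
  refine ⟨Nat.floor_pos.2 (by linarith), hle, ?_⟩
  have hℓ0 : 0 < ℓ := by linarith
  have h1 : exp (y - 2 / ℓ) ≤ ⌊exp y⌋₊ := by
    refine le_trans ?_ hlt
    have h2 : 1 + 2 / ℓ ≤ exp (2 / ℓ) := by
      have := add_one_le_exp (2 / ℓ)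
      linarith
    rw [exp_sub, div_le_iff₀ (exp_pos _)]
    have h3 : exp y * (2 / ℓ) ≥ 2 := by
      rw [ge_iff_le, ← mul_div_assoc, le_div_iff₀ hℓ0]
      linarith
    have h4 : 2 / ℓ ≤ 1 := by rw [div_le_one hℓ0]; exact hℓ
    have h5 : 0 ≤ exp y - 1 := by linarith
    nlinarith [mul_le_mul_of_nonneg_left h2 h5]
  calc exp (M * y - 2) ≤ exp (M * (y - 2 / ℓ)) := by
        refine exp_le_exp.2 ?_
        have : M * (2 / ℓ) ≤ 2 := by
          rw [← mul_div_assoc, div_le_iff₀ hℓ0]; linarith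
        linarith
    _ = exp (y - 2 / ℓ) ^ M := exp_nat_mul _ _
    _ ≤ (⌊exp y⌋₊ : ℝ) ^ M := pow_le_pow_left₀ (exp_pos _).le h1 _

/-- The degree of the universal graph. -/
theorem wordDegree_mul_le {ℓ y : ℝ} {a N t r : ℕ} (hℓ : 16 ≤ ℓ) (haN : a ≤ N) (hr : 0 < r)
    (hry : (r : ℝ) ≤ exp y) (hN : (N : ℝ) ≤ ℓ) :
    (r * wordDegree N a r t : ℝ) ≤
      exp (y + a * log ℓ + a * (y + log ℓ) + (N * t * y - a * (t * y))) := by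
  have hℓ0 : 0 < ℓ := by linarith
  have h1 : (N.choose a : ℝ) ≤ exp (a * log ℓ) := by
    rw [exp_nat_mul, exp_log hℓ0]
    refine le_trans ?_ (pow_le_pow_left₀ (by positivity) hN a)
    exact_mod_cast Nat.choose_le_pow N a
  have hr1 : (1 : ℝ) ≤ r := by exact_mod_cast hr
  have h2 : (2 * (r : ℝ) + 1) ^ a ≤ exp (a * (y + log ℓ)) := by
    rw [exp_nat_mul, exp_add, exp_log hℓ0]
    refine pow_le_pow_left₀ (by positivity) ?_ a
    have : 0 < exp y := exp_pos y
    nlinarith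
  have h3 : (((r : ℝ) ^ t) ^ (N - a)) ≤ exp (N * t * y - a * (t * y)) := by
    calc (((r : ℝ) ^ t) ^ (N - a)) ≤ ((exp y ^ t) ^ (N - a)) :=
          pow_le_pow_left₀ (by positivity) (pow_le_pow_left₀ (by positivity) hry _) _
      _ = exp (N * t * y - a * (t * y)) := by
          rw [← exp_nat_mul, ← exp_nat_mul]
          congr 1
          rw [Nat.cast_sub haN]
          ring
  rw [wordDegree]
  push_cast
  calc (r : ℝ) * (N.choose a * ((2 * (r : ℝ) + 1) ^ a * ((r : ℝ) ^ t) ^ (N - a)))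
      ≤ exp y * (exp (a * log ℓ) * (exp (a * (y + log ℓ)) * exp (N * t * y - a * (t * y)))) := by
        gcongr
    _ = _ := by
        rw [← exp_add, ← exp_add, ← exp_add]
        congr 1
        ring

theorem two_pow_ceil_ge {ℓ : ℝ} : exp (2 * ℓ) ≤ 2 ^ ⌈3 * ℓ⌉₊ := by
  have h := Nat.le_ceil (3 * ℓ)
  have hlog := log_two_gt_d9
  rw [← exp_log (show (0 : ℝ) < 2 by norm_num), ← exp_nat_mul, exp_log (by norm_num)]
  refine exp_le_exp.2 ?_
  have h0 : (0 : ℝ) ≤ ⌈3 * ℓ⌉₊ := Nat.cast_nonneg _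
  nlinarith

/-- The rounding of `a * d / 2` to an integer `N` costs at most `4 * √ℓ / d` in the exponent of the
degree of the universal graph: the covering rate `a / N` falls short of `2 / d` by at most
`2 / (d * N)`. -/
theorem covering_rate_gap {ℓ d z : ℝ} {a N : ℕ} (hℓ : 0 < ℓ) (hd : 2 < d) (hz : 0 ≤ z)
    (hN1 : a * d ≤ 2 * N) (hN2 : 2 * N ≤ a * d + 2) (hsa : √ℓ ≤ a * d)
    (hNz : N * z = ℓ * (d / (2 * d - 2))) :
    N * z - a * z ≤ ℓ * ((d - 2) / (2 * d - 2)) + 4 * (√ℓ / d) := by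
  have hs : 0 < √ℓ := sqrt_pos.2 hℓ
  have hd0 : 0 < d := by linarith
  have hd2 : 0 < 2 * d - 2 := by linarith
  have hle : N * z ≤ ℓ := by
    rw [hNz]
    refine mul_le_of_le_one_right hℓ.le ?_
    rw [div_le_one hd2]
    linarith
  have hzs : z ≤ 2 * √ℓ := by
    have h1 : √ℓ * z ≤ 2 * N * z := mul_le_mul_of_nonneg_right (hsa.trans hN1) hz
    have h2 := mul_self_sqrt hℓ.le
    have h3 : √ℓ * z ≤ √ℓ * (2 * √ℓ) := by linarith
    exact le_of_mul_le_mul_left h3 hs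
  have h1 : (2 * N - a * d) * z ≤ 2 * z := mul_le_mul_of_nonneg_right (by linarith) hz
  have h2 : ℓ * ((d - 2) / (2 * d - 2)) = N * z - 2 * (N * z) / d := by
    rw [hNz]
    have h3 : d - 1 ≠ 0 := by linarith
    have h4 : 2 * d - 2 = 2 * (d - 1) := by ring
    rw [h4]
    field_simp
  have h3 : 2 * (N * z) / d - a * z ≤ 4 * √ℓ / d := by
    rw [div_sub' hd0.ne', div_le_div_iff_of_pos_right hd0]
    linarith
  rw [h2]
  rw [mul_div_assoc 4] at h3
  linarith

/-- The size of the largest fibre, times the maximum degree. -/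
theorem fiber_bound_mul_le {ℓ κ d T b₁ b₂ D' : ℝ} {A : ℕ} (hℓ : 16 ≤ ℓ) (hd : 2 < d)
    (hb₁ : b₁ ≤ 54 * exp κ) (hb₂ : b₂ ≤ exp κ) (hD0 : 0 ≤ D') (hD : D' ≤ d * ℓ ^ 2)
    (hT : 0 ≤ T) (hTlog : log ℓ ≤ 2 * T) (hTd : log d ≤ T) :
    (b₁ + b₂) * D' ≤ exp (κ + (10 * A + 20) * T) := by
  have hℓ0 : 0 < ℓ := by linarith
  have hd0 : 0 < d := by linarith
  have h55 : (55 : ℝ) ≤ ℓ ^ 2 := by nlinarith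
  calc (b₁ + b₂) * D' ≤ (55 * exp κ) * (d * ℓ ^ 2) :=
        mul_le_mul (by linarith) hD hD0 (by positivity)
    _ ≤ (ℓ ^ 2 * exp κ) * (d * ℓ ^ 2) := by gcongr
    _ = exp (κ + (log d + 4 * log ℓ)) := by
        rw [exp_add, exp_add, exp_log hd0, show (4 : ℝ) * log ℓ = ((4 : ℕ) : ℝ) * log ℓ by
          norm_num, exp_nat_mul, exp_log hℓ0]
        ring
    _ ≤ exp (κ + (10 * A + 20) * T) := by
        have : 0 ≤ (A : ℝ) * T := by positivity
        exact exp_le_exp.2 (by linarith)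

/-- The exponent of the degree of the universal graph, times the alphabet size. -/
theorem exponent_le {ℓ κ d y z : ℝ} {a A : ℕ} (hℓ : 16 ≤ ℓ) (hd : 2 < d)
    (has : a * d ≤ √ℓ + d) (hy2 : y ≤ 2 * (A * log ℓ)) (hz : z ≤ κ + 4 * (√ℓ / d)) :
    y + a * log ℓ + a * (y + log ℓ) + z ≤ κ + (10 * A + 20) * errorTerm ℓ d := by
  have hlog := one_le_log_of_le hℓ
  have hd0 : 0 < d := by linarith
  have hT0 : 0 ≤ errorTerm ℓ d := errorTerm_nonneg (by linarith) (by linarith)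
  have hTlog : log ℓ ≤ 2 * errorTerm ℓ d := log_le_two_mul_errorTerm hℓ (by linarith)
  have hsd : √ℓ / d * log ℓ ≤ errorTerm ℓ d := by
    have := log_nonneg (show 1 ≤ d by linarith)
    rw [errorTerm, div_eq_inv_mul]
    linarith
  have hsd' : √ℓ / d ≤ errorTerm ℓ d :=
    le_trans (le_mul_of_one_le_right (by positivity) hlog) hsd
  have halog : a * log ℓ ≤ 3 * errorTerm ℓ d := by
    have h1 : (a : ℝ) ≤ √ℓ / d + 1 := by
      rw [div_add_one hd0.ne', le_div_iff₀ hd0]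
      exact has
    calc a * log ℓ ≤ (√ℓ / d + 1) * log ℓ := mul_le_mul_of_nonneg_right h1 (by linarith)
      _ = √ℓ / d * log ℓ + log ℓ := by ring
      _ ≤ 3 * errorTerm ℓ d := by linarith
  have hyT : y ≤ 4 * (A * errorTerm ℓ d) := by
    have := mul_le_mul_of_nonneg_left hTlog (Nat.cast_nonneg A)
    linarith
  have hay : a * y ≤ 6 * (A * errorTerm ℓ d) := by
    calc a * y ≤ a * (2 * (A * log ℓ)) := by gcongr
      _ = 2 * A * (a * log ℓ) := by ring
      _ ≤ 2 * A * (3 * errorTerm ℓ d) := by gcongr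
      _ = 6 * (A * errorTerm ℓ d) := by ring
  linarith

/-- A choice of parameters that realises `upperBound` when `d` is at most of order
`log n / log log n`. -/
theorem exists_parameters_le_upperBound {n Δ A : ℕ} {d δ : ℝ} (hℓ : 16 ≤ log n)
    (hδ0 : 0 < δ) (hδ : δ ≤ 1 / 2) (hA : 8 ≤ δ * A) (hd : 2 < d)
    (hδd : δ ≤ (d - 2) / (2 * d - 2))
    (hsqrt : 4 * A * log (log n) * √(log n) ≤ log n)
    (hdℓ : 2 * A * d * log (log n) ≤ log n) (hexp : 12 * log n ^ 3 ≤ exp (δ / 2 * log n))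
    (hΔ : (Δ : ℝ) ≤ d * log n ^ 2) :
    ∃ a N t r L : ℕ, a ≤ N ∧ 0 < r ∧ a * d ≤ 2 * N ∧
      dependencyBound N t Δ * r ^ (N * t) ≤ 2 ^ L ∧
      (((6 * n / r ^ (N * t) + dependencyBound N t Δ * L) * Δ : ℕ) : ℝ) ≤
        upperBound (10 * A + 20) n d ∧
      ((r * wordDegree N a r t : ℕ) : ℝ) ≤ upperBound (10 * A + 20) n d := by
  have hn0 : 0 < n := by
    rcases Nat.eq_zero_or_pos n with rfl | h
    · norm_num at hℓ
    · exact h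
  have hn : (n : ℝ) = exp (log n) := (exp_log (by exact_mod_cast hn0)).symm
  set ℓ := log n with hℓdef
  have hA1 : 1 ≤ A := by
    by_contra h
    have : A = 0 := by omega
    norm_num [this] at hA
  have hA' : (1 : ℝ) ≤ A := by exact_mod_cast hA1
  obtain ⟨a, N, t, y, ha1, haN, ht1, hN1, hN2, hsa, has, hNty, hy1, hy2⟩ :=
    exists_parameters hℓ hA1 hd hsqrt hdℓ
  have hlog := one_le_log_of_le hℓ
  have hℓ0 : 0 < ℓ := by linarith
  have hd0 : 0 < d := by linarith
  have hN0 : 1 ≤ N := ha1.trans haN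
  have ht0' : (1 : ℝ) ≤ t := by exact_mod_cast ht1
  set T := errorTerm ℓ d with hT
  have hT0 : 0 ≤ T := errorTerm_nonneg (by linarith) (by linarith)
  have hTlog : log ℓ ≤ 2 * T := log_le_two_mul_errorTerm hℓ (by linarith)
  have hTd : log d ≤ T := log_le_errorTerm (by linarith) (by linarith)
  set κ := ℓ * ((d - 2) / (2 * d - 2)) with hκ
  have hY : ℓ * (d / (2 * d - 2)) = ℓ - κ := by
    have : 2 * d - 2 ≠ 0 := by linarith
    rw [hκ, eq_sub_iff_add_eq, ← mul_add, ← add_div, show d + (d - 2) = 2 * d - 2 by ring,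
      div_self this, mul_one]
  have hκδ : δ * ℓ ≤ κ := by
    rw [hκ, mul_comm]
    exact mul_le_mul_of_nonneg_left hδd hℓ0.le
  have hκ0 : 0 ≤ κ := (mul_pos hδ0 hℓ0).le.trans hκδ
  rw [hY] at hNty
  have hNtyℓ : N * t * y ≤ ℓ := by linarith
  have hylog : log ℓ ≤ y := le_trans (le_mul_of_one_le_left (by linarith) hA') hy1
  have hNt : (N : ℝ) * t ≤ ℓ :=
    le_trans (le_mul_of_one_le_right (by positivity) (hlog.trans hylog)) hNtyℓ
  have hNℓ : (N : ℝ) ≤ ℓ := le_trans (le_mul_of_one_le_right (by positivity) ht0') hNt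
  -- the maximum degree is at most polylogarithmic
  have hdle : d ≤ ℓ := by
    have h1 : 1 * 1 ≤ A * log ℓ := mul_le_mul hA' hlog zero_le_one (by linarith)
    have h2 : d * 1 ≤ d * (2 * (A * log ℓ)) := mul_le_mul_of_nonneg_left (by linarith) hd0.le
    linarith
  have hΔ4 : (Δ : ℝ) + 2 ≤ ℓ ^ 4 := by
    have h1 : (Δ : ℝ) ≤ ℓ ^ 3 := by
      rw [pow_succ' ℓ 2]
      exact hΔ.trans (mul_le_mul_of_nonneg_right hdle (by positivity))
    have h2 : (1 : ℝ) ≤ ℓ ^ 3 := one_le_pow₀ (by linarith)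
    have h3 : 16 * ℓ ^ 3 ≤ ℓ * ℓ ^ 3 := mul_le_mul_of_nonneg_right hℓ (by positivity)
    rw [pow_succ' ℓ 3]
    linarith
  have hDep := dependencyBound_le hℓ hA1 hN0 hy1 hNtyℓ hΔ4
  have hMcast : ((N * t : ℕ) : ℝ) = N * t := by push_cast; ring
  obtain ⟨hr0, hrle, hrpow⟩ := floor_exp_pow_bounds (M := N * t) (by linarith) hylog
    (by rw [hMcast]; exact hNt)
  set r := ⌊exp y⌋₊ with hr
  rw [hMcast, hNty] at hrpow
  have hrpow' : (r : ℝ) ^ (N * t) ≤ exp ℓ := by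
    calc (r : ℝ) ^ (N * t) ≤ exp y ^ (N * t) := pow_le_pow_left₀ (by positivity) hrle _
      _ = exp (N * t * y) := by rw [← exp_nat_mul, hMcast]
      _ ≤ exp ℓ := exp_le_exp.2 hNtyℓ
  -- the dependencies are negligible
  have h4A : 4 * ℓ / A ≤ δ / 2 * ℓ := by
    rw [div_le_iff₀ (by linarith)]
    have := mul_le_mul_of_nonneg_right hA hℓ0.le
    linarith
  have hDep2 : 4 * ℓ * (3 * ℓ ^ 2 * exp (4 * ℓ / A)) ≤ exp (δ * ℓ) := by
    calc 4 * ℓ * (3 * ℓ ^ 2 * exp (4 * ℓ / A)) = 12 * ℓ ^ 3 * exp (4 * ℓ / A) := by ring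
      _ ≤ exp (δ / 2 * ℓ) * exp (δ / 2 * ℓ) :=
        mul_le_mul hexp (exp_le_exp.2 h4A) (exp_pos _).le (exp_pos _).le
      _ = exp (δ * ℓ) := by rw [← exp_add]; congr 1; ring
  have hDep3 : 4 * ℓ * (dependencyBound N t Δ : ℝ) ≤ exp (δ * ℓ) :=
    (mul_le_mul_of_nonneg_left hDep (by linarith)).trans hDep2
  have hDep0 : (0 : ℝ) ≤ dependencyBound N t Δ := Nat.cast_nonneg _
  refine ⟨a, N, t, r, ⌈3 * ℓ⌉₊, haN, hr0, hN1, ?_, ?_, ?_⟩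
  · have h1 : (dependencyBound N t Δ : ℝ) * (r : ℝ) ^ (N * t) ≤ 2 ^ ⌈3 * ℓ⌉₊ := by
      refine le_trans ?_ two_pow_ceil_ge
      have h2 : (dependencyBound N t Δ : ℝ) ≤ exp ℓ := by
        have h3 : exp (δ * ℓ) ≤ exp ℓ :=
          exp_le_exp.2 (mul_le_of_le_one_left hℓ0.le (by linarith))
        exact (le_mul_of_one_le_left hDep0 (by linarith)).trans (hDep3.trans h3)
      calc (dependencyBound N t Δ : ℝ) * (r : ℝ) ^ (N * t) ≤ exp ℓ * exp ℓ :=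
            mul_le_mul h2 hrpow' (by positivity) (exp_pos _).le
        _ = exp (2 * ℓ) := by rw [← exp_add]; congr 1; ring
    exact_mod_cast h1
  · rw [upperBound_eq_exp hn0, ← hℓdef, ← hκ, ← hT]
    have hceil : (⌈3 * ℓ⌉₊ : ℝ) ≤ 4 * ℓ := by
      have := Nat.ceil_lt_add_one (show 0 ≤ 3 * ℓ by linarith)
      linarith
    have h1 : ((dependencyBound N t Δ * ⌈3 * ℓ⌉₊ : ℕ) : ℝ) ≤ exp κ := by
      push_cast
      have h3 : exp (δ * ℓ) ≤ exp κ := exp_le_exp.2 hκδ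
      rw [mul_comm]
      exact (mul_le_mul_of_nonneg_right hceil hDep0).trans (hDep3.trans h3)
    have h2 : ((6 * n / r ^ (N * t) : ℕ) : ℝ) ≤ 54 * exp κ := by
      refine Nat.cast_div_le.trans ?_
      push_cast
      rw [div_le_iff₀ (by positivity), hn]
      have h3 : exp ℓ = exp κ * exp 2 * exp (ℓ - κ - 2) := by
        rw [← exp_add, ← exp_add]; congr 1; ring
      have h4 : exp 2 ≤ 9 := by
        rw [show (2 : ℝ) = 1 + 1 by norm_num, exp_add, show (9 : ℝ) = 3 * 3 by norm_num]
        have h5 : exp 1 ≤ 3 := exp_one_lt_d9.le.trans (by norm_num)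
        exact mul_le_mul h5 h5 (exp_pos 1).le (by norm_num)
      calc 6 * exp ℓ = 6 * exp κ * exp 2 * exp (ℓ - κ - 2) := by rw [h3]; ring
        _ ≤ 6 * exp κ * 9 * (r : ℝ) ^ (N * t) := by gcongr
        _ = 54 * exp κ * (r : ℝ) ^ (N * t) := by ring
    rw [Nat.cast_mul, Nat.cast_add]
    exact fiber_bound_mul_le hℓ hd h2 h1 (Nat.cast_nonneg _) hΔ hT0 hTlog hTd
  · rw [upperBound_eq_exp hn0, ← hℓdef, ← hκ]
    push_cast
    have hy0 : 0 ≤ y := by linarith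
    have hgap := covering_rate_gap (z := t * y) hℓ0 hd (by positivity) hN1 hN2 hsa
      (by rw [hY, ← mul_assoc, hNty])
    rw [← mul_assoc, ← hκ] at hgap
    exact (wordDegree_mul_le hℓ haN hr0 hrle hNℓ).trans
      (exp_le_exp.2 (exponent_le hℓ hd has hy2 hgap))

end Numerics

/-! ### Graphs of bounded density -/

section Deterministic

open Real

/-- The bound `O(Δ √n)` suffices when `d` is at least of order `log n / log log n`. -/
theorem tww_le_upperBound_of_large_degree {V : Type*} [Fintype V] {G : SimpleGraph V} {Δ A : ℕ}
    {d : ℝ} (hℓ : 16 ≤ log (Fintype.card V)) (hA : 1 ≤ A) (hd : 2 < d)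
    (hdℓ : log (Fintype.card V) ≤ 2 * A * d * log (log (Fintype.card V)))
    (hΔ : (Δ : ℝ) ≤ d * log (Fintype.card V) ^ 2)
    (hdeg : ∀ v, (G.neighborSet v).ncard ≤ Δ) :
    (tww G : ℝ) ≤ upperBound (10 * A + 20) (Fintype.card V) d := by
  set n := Fintype.card V with hn_def
  have hn0 : 0 < n := by
    rcases Nat.eq_zero_or_pos n with h | h
    · norm_num [h] at hℓ
    · exact h
  have hn : (n : ℝ) = exp (log n) := (exp_log (by exact_mod_cast hn0)).symm
  rw [upperBound_eq_exp hn0]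
  set ℓ := log n with hℓ_def
  have hlog := one_le_log_of_le hℓ
  have hA' : (1 : ℝ) ≤ A := by exact_mod_cast hA
  have hℓ0 : 0 < ℓ := by linarith
  have hd0 : 0 < d := by linarith
  set T := errorTerm ℓ d with hT
  have hT0 : 0 ≤ T := errorTerm_nonneg (by linarith) (by linarith)
  have hTlog : log ℓ ≤ 2 * T := log_le_two_mul_errorTerm hℓ (by linarith)
  have hTd : log d ≤ T := log_le_errorTerm (by linarith) (by linarith)
  set x := exp (ℓ / 2) with hx
  have hx0 : 0 < x := exp_pos _
  have hnx : (n : ℝ) = x * x := by rw [hn, hx, ← exp_add]; congr 1; ring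
  have hs1 : Nat.sqrt n * Nat.sqrt n ≤ n := Nat.sqrt_le n
  have hs2 : n < (Nat.sqrt n + 1) * (Nat.sqrt n + 1) := Nat.lt_succ_sqrt n
  have hs0 : Nat.sqrt n ≠ 0 := (Nat.sqrt_pos.2 hn0).ne'
  set s := Nat.sqrt n with hs
  set t := Nat.log 2 s with ht
  have ht1 : 2 ^ t ≤ s := Nat.pow_log_le_self 2 hs0
  have ht2 : s < 2 ^ (t + 1) := Nat.lt_pow_succ_log_self (by norm_num) s
  have hsx : (s : ℝ) ≤ x := by
    have : (s : ℝ) * s ≤ x * x := by rw [← hnx]; exact_mod_cast hs1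
    exact (mul_self_le_mul_self_iff (Nat.cast_nonneg _) hx0.le).2 this
  have hxs : x ≤ 2 * 2 ^ t := by
    have h1 : x * x ≤ (s + 1) * (s + 1) := by rw [← hnx]; exact_mod_cast hs2.le
    have h2 : x ≤ s + 1 := (mul_self_le_mul_self_iff hx0.le (by positivity)).2 h1
    refine h2.trans ?_
    rw [← pow_succ']
    exact_mod_cast ht2
  have htx : (2 : ℝ) ^ t ≤ x := le_trans (by exact_mod_cast ht1) hsx
  have htx' : (t : ℝ) ≤ x := by
    refine le_trans ?_ htx
    exact_mod_cast Nat.lt_two_pow_self.le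
  have hfib : ((6 * n / 2 ^ t + t : ℕ) : ℝ) ≤ 13 * x := by
    have h1 : ((6 * n / 2 ^ t : ℕ) : ℝ) ≤ 12 * x := by
      refine Nat.cast_div_le.trans ?_
      push_cast
      rw [div_le_iff₀ (by positivity), hnx]
      have := mul_le_mul_of_nonneg_left hxs hx0.le
      linarith
    rw [Nat.cast_add]
    linarith
  have hdℓ1 : 1 ≤ d * ℓ ^ 2 :=
    one_le_mul_of_one_le_of_one_le (by linarith) (one_le_pow₀ (by linarith))
  have hmain : (tww G : ℝ) ≤ 13 * x * (d * ℓ ^ 2) := by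
    refine (Nat.cast_le.2 (tww_le_of_binary_words (t := t) hdeg)).trans ?_
    rw [Nat.cast_max]
    refine max_le ?_ ?_
    · rw [Nat.cast_mul]
      exact mul_le_mul hfib hΔ (Nat.cast_nonneg _) (by positivity)
    · push_cast
      refine le_trans ?_ (le_mul_of_one_le_right (by positivity) hdℓ1)
      linarith
  have hd2 : 0 < 2 * d - 2 := by linarith
  have hκ : ℓ / 2 ≤ ℓ * ((d - 2) / (2 * d - 2)) + 4 * (A * T) := by
    have h1 : ℓ / 2 = ℓ * ((d - 2) / (2 * d - 2)) + ℓ / (2 * d - 2) := by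
      have h3 : d - 1 ≠ 0 := by linarith
      rw [show 2 * d - 2 = 2 * (d - 1) by ring]
      field_simp
      ring
    have h2 : ℓ / (2 * d - 2) ≤ ℓ / d := div_le_div_of_nonneg_left hℓ0.le hd0 (by linarith)
    have h3 : ℓ / d ≤ 2 * A * log ℓ := by rw [div_le_iff₀ hd0]; linarith
    have h4 := mul_le_mul_of_nonneg_left hTlog (Nat.cast_nonneg A)
    linarith
  refine hmain.trans ?_
  calc 13 * x * (d * ℓ ^ 2) ≤ ℓ * x * (d * ℓ ^ 2) := by
        gcongr
        linarith
    _ = exp (ℓ / 2 + (log d + 3 * log ℓ)) := by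
        rw [exp_add, exp_add, exp_log hd0, show (3 : ℝ) * log ℓ = ((3 : ℕ) : ℝ) * log ℓ by
          norm_num, exp_nat_mul, exp_log hℓ0]
        ring
    _ ≤ _ := by
        have : 0 ≤ (A : ℝ) * T := by positivity
        exact exp_le_exp.2 (by linarith)

/-- The bound for graphs all of whose subgraphs have average degree at most `d`, with maximum
degree at most `d (log n) ^ 2`. -/
theorem exists_forall_tww_le_upperBound {ε : ℝ} (hε : 0 < ε) :
    ∃ (C : ℝ) (n₀ : ℕ), 0 ≤ C ∧ ∀ (V : Type*) [Fintype V] (G : SimpleGraph V) (d : ℝ) (Δ : ℕ),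
      n₀ ≤ Fintype.card V → 2 + ε ≤ d → (Δ : ℝ) ≤ d * log (Fintype.card V) ^ 2 →
      (∀ v, (G.neighborSet v).ncard ≤ Δ) →
      (∀ F : Finset (Sym2 V), (F : Set (Sym2 V)) ⊆ G.edgeSet →
        2 * (F.card : ℝ) ≤ d * {v | ∃ e ∈ F, v ∈ e}.ncard) →
      (tww G : ℝ) ≤ upperBound C (Fintype.card V) d := by
  set δ : ℝ := ε / (2 + 2 * ε) with hδ_def
  have hδ0 : 0 < δ := by positivity
  have hδ : δ ≤ 1 / 2 := by
    rw [hδ_def, div_le_div_iff₀ (by positivity) (by norm_num)]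
    linarith
  -- with this `A`, the `n ^ (4 / A)` dependencies are negligible against `n ^ δ`, which is a lower
  -- bound for the main term
  set A : ℕ := ⌈8 / δ⌉₊ with hA_def
  have hA : 8 ≤ δ * A := by
    rw [mul_comm, ← div_le_iff₀ hδ0]
    exact Nat.le_ceil _
  have hA1 : 1 ≤ A := Nat.one_le_ceil_iff.2 (by positivity)
  have hA' : (1 : ℝ) ≤ A := by exact_mod_cast hA1
  have hev : ∀ᶠ ℓ : ℝ in atTop, 16 ≤ ℓ ∧ 4 * A * log ℓ * √ℓ ≤ ℓ ∧
      12 * ℓ ^ 3 ≤ exp (δ / 2 * ℓ) := by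
    have h1 : ∀ᶠ ℓ : ℝ in atTop, ‖log ℓ‖ ≤ 1 / (4 * A) * ‖ℓ ^ (1 / 2 : ℝ)‖ :=
      (isLittleO_log_rpow_atTop (by norm_num)).bound (by positivity)
    have h2 : ∀ᶠ ℓ : ℝ in atTop, ‖ℓ ^ 3‖ ≤ 1 / 12 * ‖exp (δ / 2 * ℓ)‖ :=
      (isLittleO_pow_exp_pos_mul_atTop 3 (show 0 < δ / 2 by positivity)).bound (by norm_num)
    filter_upwards [h1, h2, eventually_ge_atTop 16] with ℓ h1 h2 h3
    have hℓ0 : 0 ≤ ℓ := by linarith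
    refine ⟨h3, ?_, ?_⟩
    · rw [← sqrt_eq_rpow, norm_of_nonneg (sqrt_nonneg _)] at h1
      have h4 : log ℓ ≤ 1 / (4 * A) * √ℓ := (le_abs_self _).trans h1
      calc 4 * A * log ℓ * √ℓ ≤ 4 * A * (1 / (4 * A) * √ℓ) * √ℓ := by gcongr
        _ = √ℓ * √ℓ := by field_simp
        _ = ℓ := mul_self_sqrt hℓ0
    · rw [norm_of_nonneg (by positivity), norm_of_nonneg (exp_pos _).le] at h2
      linarith
  obtain ⟨n₀, hn₀⟩ := eventually_atTop.1
    ((tendsto_log_atTop.comp tendsto_natCast_atTop_atTop).eventually hev)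
  refine ⟨10 * A + 20, n₀, by positivity, fun V _ G d Δ hn hd hΔ hdeg hG => ?_⟩
  obtain ⟨h16, hsqrt, hexp⟩ := hn₀ _ hn
  simp only [Function.comp_apply] at h16 hsqrt hexp
  have hd2 : 2 < d := by linarith
  rcases le_total (2 * A * d * log (log (Fintype.card V))) (log (Fintype.card V)) with hdℓ | hdℓ
  · have hδd : δ ≤ (d - 2) / (2 * d - 2) := by
      rw [hδ_def, div_le_div_iff₀ (by positivity) (by linarith)]
      nlinarith
    obtain ⟨a, N, t, r, L, haN, hr, had, hL, h1, h2⟩ :=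
      exists_parameters_le_upperBound h16 hδ0 hδ hA hd2 hδd hsqrt hdℓ hexp hΔ
    have hdens : ∀ F : Finset (Sym2 V), (F : Set (Sym2 V)) ⊆ G.edgeSet →
        a * F.card ≤ N * {v | ∃ e ∈ F, v ∈ e}.ncard := by
      intro F hF
      have h3 := mul_le_mul_of_nonneg_left (hG F hF) (Nat.cast_nonneg (α := ℝ) a)
      have h4 := mul_le_mul_of_nonneg_right had
        (Nat.cast_nonneg (α := ℝ) {v | ∃ e ∈ F, v ∈ e}.ncard)
      have h5 : (a : ℝ) * F.card ≤ N * {v | ∃ e ∈ F, v ∈ e}.ncard := by linarith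
      exact_mod_cast h5
    refine (Nat.cast_le.2 (tww_le_of_density haN hr hdeg hdens hL)).trans ?_
    rw [Nat.cast_max]
    exact max_le h1 h2
  · exact tww_le_upperBound_of_large_degree h16 hA1 hd2 hdℓ hΔ hdeg

/-- A set of edges of a graph of maximum degree `d` spans a subgraph of average degree at most
`d`. -/
theorem two_mul_card_le_of_degree_le {V : Type*} [Fintype V] {G : SimpleGraph V} {d : ℕ}
    (hdeg : ∀ v, (G.neighborSet v).ncard ≤ d) {F : Finset (Sym2 V)}
    (hF : (F : Set (Sym2 V)) ⊆ G.edgeSet) :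
    2 * F.card ≤ d * {v | ∃ e ∈ F, v ∈ e}.ncard := by
  classical
  rw [Set.ncard_eq_toFinset_card', Set.toFinset_ofPred]
  set U : Finset V := Finset.univ.filter fun v => ∃ e ∈ F, v ∈ e with hU
  have h1 := Finset.sum_card_bipartiteAbove_eq_sum_card_bipartiteBelow (s := U) (t := F)
    (fun v e => v ∈ e)
  have h2 : ∀ v ∈ U, (F.bipartiteAbove (fun v e => v ∈ e) v).card ≤ d := by
    intro v _
    refine le_trans ?_ (hdeg v)
    rw [Set.ncard_eq_toFinset_card', ← SimpleGraph.neighborFinset_def,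
      SimpleGraph.card_neighborFinset_eq_degree, ← SimpleGraph.card_incidenceFinset_eq_degree]
    refine Finset.card_le_card fun e he => ?_
    rw [Finset.mem_bipartiteAbove] at he
    rw [SimpleGraph.mem_incidenceFinset]
    exact ⟨hF he.1, he.2⟩
  have h3 : ∀ e ∈ F, (U.bipartiteBelow (fun v e => v ∈ e) e).card = 2 := by
    intro e he
    rw [← Sym2.card_toFinset_of_not_isDiag e (G.not_isDiag_of_mem_edgeSet (hF he))]
    congr 1
    ext v
    simp only [Finset.mem_bipartiteBelow, Sym2.mem_toFinset, hU, Finset.mem_filter,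
      Finset.mem_univ, true_and, and_iff_right_iff_imp]
    exact fun h => ⟨e, he, h⟩
  rw [Finset.sum_congr rfl h3, Finset.sum_const, smul_eq_mul] at h1
  have h4 := Finset.sum_le_card_nsmul U _ d h2
  rw [smul_eq_mul] at h4
  linarith

/-- Regular graphs satisfy the density condition by double counting; the finitely many small
orders are absorbed by the constant. -/
theorem exists_forall_regular_tww_le_upperBound :
    ∃ C : ℝ, ∀ (V : Type*) [Fintype V] (G : SimpleGraph V) [DecidableRel G.Adj] (d : ℕ),
      2 < d → G.IsRegularOfDegree d → (tww G : ℝ) ≤ upperBound C (Fintype.card V) d := by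
  classical
  obtain ⟨C, n₀, hC0, hC⟩ := exists_forall_tww_le_upperBound (ε := 1) one_pos
  refine ⟨max C (6 * n₀ * n₀ + 2), fun V _ G _ d hd hreg => ?_⟩
  have hdeg : ∀ v, (G.neighborSet v).ncard = d := by
    intro v
    rw [Set.ncard_eq_toFinset_card', ← SimpleGraph.neighborFinset_def,
      SimpleGraph.card_neighborFinset_eq_degree, hreg v]
  rcases isEmpty_or_nonempty V with hV | ⟨⟨v₀⟩⟩
  · have h1 : tww G ≤ 0 := by
      simpa [wordDegree] using tww_le_of_words (G := G) (N := 0) (r := 1) (a := 1) (t := 0)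
        (B := 0) (Δ := 0) one_pos (L := fun v => hV.elim v) (fun v => hV.elim v)
        (fun v => hV.elim v) (fun v => hV.elim v)
    rw [Nat.le_zero.1 h1, upperBound]
    push_cast
    positivity
  have hdn : d < Fintype.card V := hreg v₀ ▸ G.degree_lt_card_verts v₀
  have hlog : 1 ≤ log (Fintype.card V) := by
    rw [le_log_iff_exp_le (by exact_mod_cast (by omega))]
    have : (4 : ℝ) ≤ Fintype.card V := by exact_mod_cast (by omega)
    linarith [exp_one_lt_d9]
  have hd' : (3 : ℝ) ≤ d := by exact_mod_cast hd
  have hn0 : 0 < Fintype.card V := by omega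
  have hT := log_le_errorTerm hlog (show (1 : ℝ) ≤ d by linarith)
  have hlogd : 1 ≤ log (d : ℝ) := by
    rw [le_log_iff_exp_le (by linarith)]
    linarith [exp_one_lt_d9]
  have hT1 : 1 ≤ errorTerm (log (Fintype.card V)) d := hlogd.trans hT
  rcases le_total n₀ (Fintype.card V) with hn | hn
  · refine (hC V G d d hn (by linarith) (le_mul_of_one_le_right (by linarith)
      (one_le_pow₀ hlog)) (fun v => (hdeg v).le) ?_).trans ?_
    · intro F hF
      exact_mod_cast two_mul_card_le_of_degree_le (fun v => (hdeg v).le) hF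
    · rw [upperBound_eq_exp hn0, upperBound_eq_exp hn0]
      have := mul_le_mul_of_nonneg_right (le_max_left C (6 * n₀ * n₀ + 2))
        (zero_le_one.trans hT1)
      exact exp_le_exp.2 (by linarith)
  · set n := Fintype.card V with hn_def
    have h1 := tww_le_of_binary_words (G := G) (t := 0) (fun v => ((hdeg v).trans_lt hdn).le)
    have h2 : tww G ≤ 6 * n₀ * n₀ + 2 := by
      refine h1.trans (max_le ?_ (by omega))
      rw [pow_zero, Nat.div_one, add_zero]
      exact (Nat.mul_le_mul (Nat.mul_le_mul_left 6 hn) hn).trans (Nat.le_add_right _ _)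
    have h3 : (tww G : ℝ) ≤ 6 * n₀ * n₀ + 2 := by exact_mod_cast h2
    rw [upperBound_eq_exp hn0]
    have h4 : 0 ≤ log n * (((d : ℝ) - 2) / (2 * d - 2)) :=
      mul_nonneg (by linarith) (div_nonneg (by linarith) (by linarith))
    have h5 : (6 * n₀ * n₀ + 2 : ℝ) ≤ max C (6 * n₀ * n₀ + 2) * errorTerm (log n) d :=
      (le_max_right _ _).trans
        (le_mul_of_one_le_right (le_trans (by positivity) (le_max_right _ _)) hT1)
    refine h3.trans (le_trans ?_ (add_one_le_exp _))
    linarith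

end Deterministic

/-! ### The maximum average degree -/

section MaximumAverageDegree

variable {V : Type*} [Finite V] {G : SimpleGraph V}

theorem le_mad {H : G.Subgraph} (hH : H.verts.Nonempty) :
    2 * (H.edgeSet.ncard : ℝ) / H.verts.ncard ≤ mad G :=
  le_ciSup (f := fun H : {H : G.Subgraph // H.verts.Nonempty} =>
    2 * (H.1.edgeSet.ncard : ℝ) / (H.1.verts.ncard : ℝ)) (Set.finite_range _).bddAbove ⟨H, hH⟩

theorem average_degree_le_mad [Nonempty V] :
    2 * (G.edgeSet.ncard : ℝ) / Nat.card V ≤ mad G := by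
  have := le_mad (G := G) (H := ⊤) (by simp)
  simpa [Set.ncard_univ] using this

/-- A set of edges of `G` spans at least `2 / mad G` times as many vertices. -/
theorem two_mul_card_le_mad_mul {F : Finset (Sym2 V)} (hF : (F : Set (Sym2 V)) ⊆ G.edgeSet) :
    2 * (F.card : ℝ) ≤ mad G * {v | ∃ e ∈ F, v ∈ e}.ncard := by
  rcases F.eq_empty_or_nonempty with rfl | hne
  · simp
  let H : G.Subgraph :=
    { verts := {v | ∃ e ∈ F, v ∈ e}
      Adj := fun u v => s(u, v) ∈ F
      adj_sub := fun h => hF h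
      edge_vert := fun {u v} h => ⟨s(u, v), h, Sym2.mem_mk_left u v⟩
      symm := ⟨fun u v h => by rwa [Sym2.eq_swap]⟩ }
  have hH : H.verts.Nonempty := by
    obtain ⟨e, he⟩ := hne
    exact ⟨e.out.1, e, he, Sym2.out_fst_mem e⟩
  have hE : H.edgeSet = F := by
    ext e
    induction e with
    | _ u v => rfl
  have h1 := le_mad hH
  have hpos : (0 : ℝ) < H.verts.ncard := by
    exact_mod_cast (Set.ncard_pos (Set.toFinite _)).2 hH
  rw [div_le_iff₀ hpos, hE, Set.ncard_coe_finset] at h1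
  exact h1

end MaximumAverageDegree

/-! ### The maximum degree of random graphs -/

section RandomGraph

open Finset

theorem choose_mul_pow_le {M m : ℕ} (hm : m ≤ M) (D : ℕ) :
    m.choose D * M ^ D ≤ m ^ D * M.choose D := by
  have h : m.descFactorial D * M ^ D ≤ m ^ D * M.descFactorial D := by
    induction D with
    | zero => simp
    | succ D ih =>
      rw [Nat.descFactorial_succ, Nat.descFactorial_succ, pow_succ, pow_succ]
      have h1 : (m - D) * M ≤ m * (M - D) := by
        rcases le_total m D with h | h
        · simp [Nat.sub_eq_zero_of_le h]
        · obtain ⟨k, rfl⟩ := Nat.exists_eq_add_of_le h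
          obtain ⟨l, rfl⟩ := Nat.exists_eq_add_of_le hm
          rw [Nat.add_sub_cancel_left, show D + k + l - D = k + l by omega]
          nlinarith
      calc (m - D) * m.descFactorial D * (M ^ D * M)
          = (m.descFactorial D * M ^ D) * ((m - D) * M) := by ring
        _ ≤ (m ^ D * M.descFactorial D) * (m * (M - D)) := Nat.mul_le_mul ih h1
        _ = m ^ D * m * ((M - D) * M.descFactorial D) := by ring
  rw [Nat.descFactorial_eq_factorial_mul_choose, Nat.descFactorial_eq_factorial_mul_choose] at h
  refine Nat.le_of_mul_le_mul_left ?_ D.factorial_pos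
  linarith

/-- A random `m`-subset of an `M`-set contains a given `D`-set with probability at most
`(m / M) ^ D`. -/
theorem card_filter_subset_mul_le {α : Type*} [DecidableEq α] {E T : Finset α} {m : ℕ}
    (hT : T ⊆ E) (hm : m ≤ #E) :
    #{X ∈ powersetCard m E | T ⊆ X} * #E ^ #T ≤ m ^ #T * (#E).choose m := by
  rcases lt_or_ge m #T with hlt | hle
  · have : #{X ∈ powersetCard m E | T ⊆ X} = 0 := by
      rw [card_eq_zero, filter_eq_empty_iff]
      intro X hX hTX
      have := card_le_card hTX
      rw [(mem_powersetCard.1 hX).2] at this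
      omega
    simp [this]
  have h1 : #{X ∈ powersetCard m E | T ⊆ X} ≤ (#E - #T).choose (m - #T) := by
    rw [← card_sdiff_of_subset hT, ← card_powersetCard]
    refine card_le_card_of_injOn (fun X => X \ T) ?_ ?_
    · intro X hX
      simp only [coe_filter, mem_powersetCard, Set.mem_ofPred_eq] at hX
      rw [mem_coe, mem_powersetCard]
      exact ⟨sdiff_subset_sdiff hX.1.1 le_rfl, by rw [card_sdiff_of_subset hX.2, hX.1.2]⟩
    · intro X hX Y hY h
      simp only [coe_filter, Set.mem_ofPred_eq] at hX hY
      rw [← sdiff_union_of_subset hX.2, ← sdiff_union_of_subset hY.2]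
      exact congrArg (· ∪ T) h
  have h2 := Nat.choose_mul (n := #E) hle
  have h3 := choose_mul_pow_le hm #T
  have h4 : 0 < (#E).choose #T := Nat.choose_pos (card_le_card hT)
  refine Nat.le_of_mul_le_mul_left ?_ h4
  calc (#E).choose #T * (#{X ∈ powersetCard m E | T ⊆ X} * #E ^ #T)
      ≤ (#E).choose #T * ((#E - #T).choose (m - #T) * #E ^ #T) :=
        Nat.mul_le_mul_left _ (Nat.mul_le_mul_right _ h1)
    _ = (#E).choose m * (m.choose #T * #E ^ #T) := by rw [← mul_assoc, ← h2, mul_assoc]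
    _ ≤ (#E).choose m * (m ^ #T * (#E).choose #T) := Nat.mul_le_mul_left _ h3
    _ = (#E).choose #T * (m ^ #T * (#E).choose m) := by ring

/-- A union bound over all stars with `D` edges. -/
theorem card_filter_large_degree_le {n m D : ℕ} (hn : 2 ≤ n) (hm : m ≤ n.choose 2)
    {E : Finset (Sym2 (Fin n))} (hE : E = (⊤ : SimpleGraph (Fin n)).edgeFinset) :
    (#{X ∈ powersetCard m E | ∃ v, D ≤ #{e ∈ X | v ∈ e}} : ℝ) ≤
      n * ((2 * m / n) ^ D / D.factorial) * (n.choose 2).choose m := by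
  have hEcard : #E = n.choose 2 := by
    rw [hE, SimpleGraph.card_edgeFinset_top_eq_card_choose_two, Fintype.card_fin]
  let star : Fin n → Finset (Sym2 (Fin n)) := fun v => E.filter fun e => v ∈ e
  have hstar : ∀ v, #(star v) = n - 1 := by
    intro v
    have h1 := (⊤ : SimpleGraph (Fin n)).card_incidenceFinset_eq_degree v
    rw [SimpleGraph.complete_graph_degree, Fintype.card_fin] at h1
    rw [← h1, SimpleGraph.incidenceFinset_eq_filter, ← hE]
  have hsub : {X ∈ powersetCard m E | ∃ v, D ≤ #{e ∈ X | v ∈ e}} ⊆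
      univ.biUnion fun v => (powersetCard D (star v)).biUnion fun T =>
        {X ∈ powersetCard m E | T ⊆ X} := by
    intro X hX
    rw [mem_filter] at hX
    obtain ⟨hX, v, hv⟩ := hX
    obtain ⟨T, hT, hTD⟩ := exists_subset_card_eq hv
    have hXE := (mem_powersetCard.1 hX).1
    refine mem_biUnion.2 ⟨v, mem_univ _, mem_biUnion.2 ⟨T, mem_powersetCard.2 ⟨fun e he => ?_, hTD⟩,
      mem_filter.2 ⟨hX, fun e he => (mem_filter.1 (hT he)).1⟩⟩⟩
    have := mem_filter.1 (hT he)
    exact mem_filter.2 ⟨hXE this.1, this.2⟩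
  have hM : (0 : ℝ) < n.choose 2 := by exact_mod_cast Nat.choose_pos hn
  have hn0 : (0 : ℝ) < n := by exact_mod_cast (by omega : 0 < n)
  set q : ℝ := (m : ℝ) / n.choose 2 with hq
  have hT : ∀ v, ∀ T ∈ powersetCard D (star v),
      (#{X ∈ powersetCard m E | T ⊆ X} : ℝ) ≤ q ^ D * (n.choose 2).choose m := by
    intro v T hT
    rw [mem_powersetCard] at hT
    have h := card_filter_subset_mul_le (hT.1.trans (filter_subset _ _)) (hm.trans_eq hEcard.symm)
    rw [hT.2, hEcard] at h
    rw [hq, div_pow, div_mul_eq_mul_div, le_div_iff₀ (by positivity)]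
    exact_mod_cast h
  have hchoose : ((n - 1).choose D : ℝ) ≤ (n - 1 : ℝ) ^ D / D.factorial := by
    have := Nat.choose_le_pow_div (α := ℝ) D (n - 1)
    rwa [Nat.cast_sub (by omega), Nat.cast_one] at this
  have hqn : (n - 1 : ℝ) * q = 2 * m / n := by
    have h1 : (n.choose 2 : ℝ) = n * (n - 1) / 2 := Nat.cast_choose_two ℝ n
    have h2 : (n : ℝ) - 1 ≠ 0 := by
      have : (2 : ℝ) ≤ n := by exact_mod_cast hn
      linarith
    rw [hq, h1]
    field_simp
  have hq0 : 0 ≤ q := by positivity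
  calc (#{X ∈ powersetCard m E | ∃ v, D ≤ #{e ∈ X | v ∈ e}} : ℝ)
      ≤ ∑ v, ∑ T ∈ powersetCard D (star v), (#{X ∈ powersetCard m E | T ⊆ X} : ℝ) := by
        have h := (card_le_card hsub).trans (card_biUnion_le.trans
          (sum_le_sum fun v _ => card_biUnion_le))
        exact_mod_cast h
    _ ≤ ∑ _v : Fin n, ((n - 1).choose D : ℝ) * (q ^ D * (n.choose 2).choose m) := by
        refine sum_le_sum fun v _ => (sum_le_card_nsmul _ _ _ (hT v)).trans ?_
        rw [card_powersetCard, hstar, nsmul_eq_mul]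
    _ = n * (((n - 1).choose D : ℝ) * q ^ D * (n.choose 2).choose m) := by
        simp [mul_assoc]
    _ ≤ n * ((n - 1 : ℝ) ^ D / D.factorial * q ^ D * (n.choose 2).choose m) := by gcongr
    _ = n * ((2 * m / n) ^ D / D.factorial) * (n.choose 2).choose m := by
        rw [← hqn, mul_pow]
        ring

instance simpleGraphMeasurableSingletonClass {V : Type*} [Countable V] :
    MeasurableSingletonClass (SimpleGraph V) where
  measurableSet_singleton G := by
    have h : {G} = ⋂ u, ⋂ v, {H : SimpleGraph V | H.Adj u v ↔ G.Adj u v} := by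
      ext H
      simp only [Set.mem_singleton_iff, Set.mem_iInter, Set.mem_ofPred_eq]
      exact ⟨fun h => by simp [h], fun h => by ext u v; exact h u v⟩
    rw [h]
    refine MeasurableSet.iInter fun u => MeasurableSet.iInter fun v => ?_
    have hm : Measurable fun H : SimpleGraph V => H.Adj u v :=
      SimpleGraph.measurable_iff_adj.1 measurable_id u v
    exact measurableSet_setOfPred.2 (hm.iff measurable_const)

theorem uniformOn_graphsWithEdges_large_degree_le {n m D : ℕ} (hn : 2 ≤ n)
    (hm : m ≤ n.choose 2) :
    uniformOn (graphsWithEdges n m) {G | ∃ v, D ≤ (G.neighborSet v).ncard} ≤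
      ENNReal.ofReal (n * ((2 * m / n) ^ D / D.factorial)) := by
  classical
  set E := (⊤ : SimpleGraph (Fin n)).edgeFinset with hE
  have hEcard : #E = n.choose 2 := by
    rw [hE, SimpleGraph.card_edgeFinset_top_eq_card_choose_two, Fintype.card_fin]
  let S : Finset (SimpleGraph (Fin n)) := univ.filter fun G => G.edgeSet.ncard = m
  let B : Finset (SimpleGraph (Fin n)) := univ.filter fun G => ∃ v, D ≤ (G.neighborSet v).ncard
  have hS : graphsWithEdges n m = S := by ext; simp [graphsWithEdges, S]
  have hB : {G : SimpleGraph (Fin n) | ∃ v, D ≤ (G.neighborSet v).ncard} = B := by ext; simp [B]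
  have hedge : ∀ G ∈ S, G.edgeFinset ∈ powersetCard m E := by
    intro G hG
    simp only [S, mem_filter, mem_univ, true_and] at hG
    rw [mem_powersetCard]
    refine ⟨SimpleGraph.edgeFinset_mono le_top, ?_⟩
    rw [← hG, ← SimpleGraph.coe_edgeFinset, Set.ncard_coe_finset]
  have hScard : #S = (n.choose 2).choose m := by
    rw [← hEcard, ← card_powersetCard]
    refine card_bij (fun G _ => G.edgeFinset) hedge (fun G _ H _ h => ?_) fun X hX => ?_
    · exact SimpleGraph.edgeFinset_inj.1 h
    · rw [mem_powersetCard] at hX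
      have hdiag : ∀ e ∈ X, ¬ e.IsDiag := fun e he =>
        SimpleGraph.not_isDiag_of_mem_edgeSet _ (SimpleGraph.mem_edgeFinset.1 (hX.1 he))
      have hset : (SimpleGraph.fromEdgeSet (X : Set (Sym2 (Fin n)))).edgeSet = X := by
        rw [SimpleGraph.edgeSet_fromEdgeSet]
        ext e
        simp only [Set.mem_sdiff, mem_coe, and_iff_left_iff_imp]
        exact fun he => hdiag e he
      refine ⟨SimpleGraph.fromEdgeSet X, ?_, ?_⟩
      · simp only [S, mem_filter, mem_univ, true_and, hset, Set.ncard_coe_finset, hX.2]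
      · rw [← coe_inj, SimpleGraph.coe_edgeFinset, hset]
  have hBcard : #(S ∩ B) ≤ #{X ∈ powersetCard m E | ∃ v, D ≤ #{e ∈ X | v ∈ e}} := by
    refine card_le_card_of_injOn (fun G => G.edgeFinset) (fun G hG => ?_) (fun G _ H _ h =>
      SimpleGraph.edgeFinset_inj.1 h)
    rw [mem_coe, mem_inter] at hG
    obtain ⟨v, hv⟩ := (mem_filter.1 hG.2).2
    refine mem_coe.2 (mem_filter.2 ⟨hedge G hG.1, v, hv.trans (le_of_eq ?_)⟩)
    rw [Set.ncard_eq_toFinset_card', ← SimpleGraph.neighborFinset_def,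
      SimpleGraph.card_neighborFinset_eq_degree, ← SimpleGraph.card_incidenceFinset_eq_degree,
      SimpleGraph.incidenceFinset_eq_filter]
  have hpos : (0 : ℝ) < (n.choose 2).choose m := by exact_mod_cast Nat.choose_pos hm
  have hreal := (Nat.cast_le (α := ℝ).2 hBcard).trans (card_filter_large_degree_le hn hm hE)
  rw [hS, hB, uniformOn_apply_finset, hScard]
  refine ENNReal.div_le_of_le_mul ?_
  rw [← ENNReal.ofReal_natCast (Nat.choose _ m), ← ENNReal.ofReal_mul (by positivity),
    ← ENNReal.ofReal_natCast]
  exact ENNReal.ofReal_le_ofReal hreal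

end RandomGraph

/-! ### Sparse random graphs -/

section RandomGraphTwinWidth

open Real

theorem pow_div_factorial_le {ℓ μ : ℝ} {D : ℕ} (hℓ : 16 ≤ ℓ) (hμ : 2 ≤ μ) (hD : μ * ℓ ^ 2 ≤ D) :
    exp ℓ * (μ ^ D / D.factorial) ≤ exp (-ℓ) := by
  have hℓ2 : 16 * ℓ ≤ ℓ ^ 2 := by rw [sq]; exact mul_le_mul_of_nonneg_right hℓ (by linarith)
  have h2D : 2 * ℓ ≤ D := by
    have : 2 * ℓ ^ 2 ≤ μ * ℓ ^ 2 := mul_le_mul_of_nonneg_right hμ (sq_nonneg ℓ)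
    linarith
  have hD0 : (0 : ℝ) < D := by linarith
  have h1 : (D : ℝ) ^ D / D.factorial ≤ exp D := pow_div_factorial_le_exp _ hD0.le _
  have h2 : μ ≤ exp (-2) * D := by
    have h3 : exp 2 ≤ ℓ ^ 2 := by
      rw [show (2 : ℝ) = 1 + 1 by norm_num, exp_add]
      have h4 := exp_one_lt_d9
      have h5 : exp 1 * exp 1 ≤ 3 * 3 :=
        mul_le_mul (by linarith) (by linarith) (exp_pos 1).le (by norm_num)
      norm_num at h5 ⊢
      linarith
    rw [exp_neg, inv_mul_eq_div, le_div_iff₀ (exp_pos _)]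
    exact (mul_le_mul_of_nonneg_left h3 (by linarith)).trans hD
  calc exp ℓ * (μ ^ D / D.factorial) ≤ exp ℓ * ((exp (-2) * D) ^ D / D.factorial) := by
        gcongr
    _ = exp ℓ * (exp (D * (-2)) * ((D : ℝ) ^ D / D.factorial)) := by
        rw [mul_pow, ← exp_nat_mul]; ring
    _ ≤ exp ℓ * (exp (D * (-2)) * exp D) := by gcongr
    _ = exp (ℓ - D) := by rw [← exp_add, ← exp_add]; congr 1; ring
    _ ≤ exp (-ℓ) := exp_le_exp.2 (by linarith)

/-- Random graphs with at least `(1 + ε) n` edges: with high probability no degree exceeds the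
average degree by more than a factor `(log n) ^ 2`, and then the bound for graphs of bounded density
applies with `d = mad G`. -/
theorem exists_forall_tendsto_uniformOn {ε : ℝ} (hε : 0 < ε) : ∃ C : ℝ, ∀ m : ℕ → ℕ,
    (∀ᶠ n : ℕ in atTop, (1 + ε) * (n : ℝ) ≤ (m n : ℝ) ∧ m n ≤ n.choose 2) →
      Tendsto (fun n : ℕ => uniformOn (graphsWithEdges n (m n))
        {G : SimpleGraph (Fin n) | (tww G : ℝ) ≤ upperBound C n (mad G)}) atTop (𝓝 1) := by
  obtain ⟨C, n₀, -, hC⟩ := exists_forall_tww_le_upperBound.{0} (show 0 < 2 * ε by linarith)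
  refine ⟨C, fun m hm => ?_⟩
  have hlog : ∀ᶠ n : ℕ in atTop, (16 : ℝ) ≤ log n :=
    (tendsto_log_atTop.comp tendsto_natCast_atTop_atTop).eventually_ge_atTop 16
  have hlim : Tendsto (fun n : ℕ => 1 - ENNReal.ofReal (exp (-log n))) atTop (𝓝 1) := by
    have h1 : Tendsto (fun n : ℕ => exp (-log n)) atTop (𝓝 0) :=
      tendsto_exp_neg_atTop_nhds_zero.comp (tendsto_log_atTop.comp tendsto_natCast_atTop_atTop)
    have h2 := ENNReal.tendsto_ofReal h1
    rw [ENNReal.ofReal_zero] at h2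
    simpa using ENNReal.Tendsto.sub tendsto_const_nhds h2 (Or.inl ENNReal.one_ne_top)
  refine tendsto_of_tendsto_of_tendsto_of_le_of_le' hlim tendsto_const_nhds ?_ ?_
  · filter_upwards [hm, hlog, eventually_ge_atTop n₀, eventually_ge_atTop 2] with n hmn hℓ hn hn2
    obtain ⟨hm1, hm2⟩ := hmn
    have hn0 : (0 : ℝ) < n := by exact_mod_cast (by omega : 0 < n)
    set μ : ℝ := 2 * m n / n with hμ
    have hμ2 : 2 + 2 * ε ≤ μ := by
      rw [hμ, le_div_iff₀ hn0]
      linarith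
    set D : ℕ := ⌊μ * log n ^ 2⌋₊ + 1 with hD
    have hDge : μ * log n ^ 2 ≤ D := by
      rw [hD]
      push_cast
      exact (Nat.lt_floor_add_one _).le
    have hfin : (graphsWithEdges n (m n)).Finite := Set.toFinite _
    have hne : (graphsWithEdges n (m n)).Nonempty := by
      classical
      obtain ⟨X, hX, hXm⟩ := Finset.exists_subset_card_eq
        (s := (⊤ : SimpleGraph (Fin n)).edgeFinset) (n := m n)
        (by rwa [SimpleGraph.card_edgeFinset_top_eq_card_choose_two, Fintype.card_fin])
      refine ⟨SimpleGraph.fromEdgeSet X, ?_⟩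
      have hset : (SimpleGraph.fromEdgeSet (X : Set (Sym2 (Fin n)))).edgeSet = X := by
        rw [SimpleGraph.edgeSet_fromEdgeSet]
        ext e
        simp only [Set.mem_sdiff, Finset.mem_coe, and_iff_left_iff_imp]
        exact fun he =>
          SimpleGraph.not_isDiag_of_mem_edgeSet _ (SimpleGraph.mem_edgeFinset.1 (hX he))
      simp only [graphsWithEdges, Set.mem_ofPred_eq, hset, Set.ncard_coe_finset, hXm]
    have hbad : uniformOn (graphsWithEdges n (m n))
        {G : SimpleGraph (Fin n) | (tww G : ℝ) ≤ upperBound C n (mad G)}ᶜ ≤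
          ENNReal.ofReal (exp (-log n)) := by
      rw [← uniformOn_inter_self hfin]
      refine (MeasureTheory.measure_mono (t := {G | ∃ v, D ≤ (G.neighborSet v).ncard}) ?_).trans
        ((uniformOn_graphsWithEdges_large_degree_le hn2 hm2).trans
          (ENNReal.ofReal_le_ofReal ?_))
      · rintro G ⟨hG, hG'⟩
        by_contra hcon
        simp only [Set.mem_ofPred_eq, not_exists, not_le] at hcon
        refine hG' ?_
        have : Nonempty (Fin n) := ⟨⟨0, by omega⟩⟩
        have hmad : μ ≤ mad G := by
          have h1 := average_degree_le_mad (G := G)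
          rwa [show G.edgeSet.ncard = m n from hG, Nat.card_eq_fintype_card, Fintype.card_fin]
            at h1
        have h2 := hC (Fin n) G (mad G) ⌊μ * log n ^ 2⌋₊ (by rwa [Fintype.card_fin])
          (hμ2.trans hmad)
          (by
            rw [Fintype.card_fin]
            refine (Nat.floor_le ?_).trans (mul_le_mul_of_nonneg_right hmad (sq_nonneg _))
            exact mul_nonneg (by linarith) (sq_nonneg _))
          (fun v => Nat.lt_succ_iff.1 (hcon v)) (fun F hF => two_mul_card_le_mad_mul hF)
        rwa [Fintype.card_fin] at h2
      · have := pow_div_factorial_le hℓ (by linarith) hDge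
        rwa [exp_log hn0] at this
    have hsum := uniformOn_compl
      {G : SimpleGraph (Fin n) | (tww G : ℝ) ≤ upperBound C n (mad G)} hfin hne
    rw [tsub_le_iff_right, ← hsum]
    gcongr
  · exact Eventually.of_forall fun n => MeasureTheory.prob_le_one

end RandomGraphTwinWidth

end SparseTwinWidth


theorem theorem1p4 :
    (∃ C : ℝ, ∀ (V : Type*) [Fintype V] (G : SimpleGraph V) [DecidableRel G.Adj] (d : ℕ),
      2 < d → G.IsRegularOfDegree d →
        (SparseTwinWidth.tww G : ℝ) ≤ SparseTwinWidth.upperBound C (Fintype.card V) d) ∧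
    (∀ ε : ℝ, 0 < ε → ∃ C : ℝ, ∀ m : ℕ → ℕ,
      (∀ᶠ n : ℕ in atTop, (1 + ε) * (n : ℝ) ≤ (m n : ℝ) ∧ m n ≤ n.choose 2) →
        Tendsto
          (fun n : ℕ => uniformOn (SparseTwinWidth.graphsWithEdges n (m n))
            {G : SimpleGraph (Fin n) |
              (SparseTwinWidth.tww G : ℝ) ≤
                SparseTwinWidth.upperBound C n (SparseTwinWidth.mad G)})
          atTop (𝓝 1)) :=
  ⟨SparseTwinWidth.exists_forall_regular_tww_le_upperBound,
    fun _ hε => SparseTwinWidth.exists_forall_tendsto_uniformOn hε⟩
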